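/- For a real tensor $\mathcal W\in\mathbb R^{n_1\times\cdots\times n_K}$ with $N=\prod_k n_k$ entries (all $n_k\ge 1$), let $W_{(k)}\in\mathbb R^{n_k\times N/n_k}$ be its mode-$k$ unfolding (the columns are the mode-$k$ fibers), $\|\cdot\|_{\mathrm{tr}}$ the sum of the singular values of a matrix, $\langle\mathcal W,\mathcal X\rangle$ the entrywise inner product, $\|\mathcal W\|_F=\sqrt{\langle\mathcal W,\mathcal W\rangle}$, and $$\|\mathcal W\|_{\mathrm{soverlap}}=\sum_{k=1}^K\frac1{\sqrt{n_k}}\|W_{(k)}\|_{\mathrm{tr}} .$$ (i) If $r_k=\operatorname{rank}W_{(k)}$, then $\|\mathcal W\|_{\mathrm{soverlap}}\le\sum_{k=1}^K\sqrt{r_k/n_k}\;\|\mathcal W\|_F$. (ii) There are absolute constants $c_1,c_2>0$ such that the following holds for all $K\ge1$, all $n_1,\dots,n_K\ge 1$ and all $m\ge1$. Let $Y\subseteq\mathbb R$, let $l:\mathbb R\times Y\to\mathbb R$ be a measurable loss that is $\Lambda$-Lipschitz in its first argument, and let $\mu$ be a probability law of $(\mathcal X,y)\in\mathbb R^{n_1\times\cdots\times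 n_K}\times Y$ under which the entries of $\mathcal X$ are independent standard Gaussian variables and $l(\langle\mathcal W,\mathcal X\rangle,y)$ is integrable for every $\mathcal W$. Put $R(\mathcal W)=\mathbb E_\mu\, l(\langle\mathcal W,\mathcal X\rangle,y)$ and, for an i.i.d. sample $(\mathcal X_i,y_i)_{i\le m}$ from $\mu$, $\hat R(\mathcal W)=\frac1m\sum_{i=1}^m l(\langle\mathcal W,\mathcal X_i\rangle,y_i)$. Let $\mathcal W^0$ minimize $R$ over $\{\|\mathcal W\|_{\mathrm{soverlap}}\le B_0\}$, let $r_k$ be the rank of its mode-$k$ unfolding, and suppose that $\|\mathcal W^0\|_F\le B$ and $B_0\le B\sum_k\sqrt{r_k/n_k}$. Let $0<\delta<1$. (a) If $l$ takes values in $[0,1]$, then with probability at least $1-\delta$ over the sample, every minimizer $\hat{\mathcal W}$ of $\hat R$ over $\{\|\mathcal W\|_{\mathrm{soverlap}}\le B_0\}$ satisfies $$R(\hat{\mathcal W})-R(\mathcal W^0)\le c_1\Lambda\frac{B}{\sqrt m}\Big(\sum_{k=1}^K\sqrt{\tfrac{r_k}{n_k}}\Big)\min_k\big(n_k+\sqrt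 N\big)+c_2\sqrt{\frac{\log(2/\delta)}{2m}} .$$ (b) Without the assumption that $l$ takes values in $[0,1]$, the same holds with the constant $c_2$ in the last term replaced by $c_2\Lambda\rho$, where $\rho$ is any number such that $\|\mathcal W\|_F\le\rho$ whenever $\|\mathcal W\|_{\mathrm{soverlap}}\le B_0$. -/

import Mathlib

open MeasureTheory ProbabilityTheory
open scoped NNReal ENNReal

namespace TensorRisk

noncomputable section

/-- Real `K`-way tensors of size `n 0 × ⋯ × n (K - 1)`. -/
abbrev Tensor {K : ℕ} (n : Fin K → ℕ) : Type := ((k : Fin K) → Fin (n k)) → ℝ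

/-- The entrywise inner product of two tensors. -/
def tensorInner {K : ℕ} {n : Fin K → ℕ} (W X : Tensor n) : ℝ := ∑ i, W i * X i

/-- The Frobenius norm. -/
def frobNorm {K : ℕ} {n : Fin K → ℕ} (W : Tensor n) : ℝ := √(tensorInner W W)

/-- The mode-`k` unfolding: rows are indexed by the `k`-th index of the tensor, and the columns,
which are the mode-`k` fibers, by the tuple of all the other indices. -/
def unfolding {K : ℕ} {n : Fin K → ℕ} (W : Tensor n) (k : Fin K) :
    Matrix (Fin (n k)) ((j : {j : Fin K // j ≠ k}) → Fin (n j)) ℝ :=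
  Matrix.of fun a f => W ((Equiv.piSplitAt k fun j => Fin (n j)).symm (a, f))

theorem unfolding_apply {K : ℕ} {n : Fin K → ℕ} (W : Tensor n) (k : Fin K)
    (i : (k : Fin K) → Fin (n k)) : unfolding W k (i k) (fun j => i j) = W i := by
  have h : ((i k, fun j : {j : Fin K // j ≠ k} => i j) :
      Fin (n k) × ((j : {j : Fin K // j ≠ k}) → Fin (n j))) =
      Equiv.piSplitAt k (fun j => Fin (n j)) i := rfl
  simp only [unfolding, Matrix.of_apply]
  rw [h, Equiv.symm_apply_apply]

/-- The mode-`k` rank of a tensor. -/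
def modeRank {K : ℕ} {n : Fin K → ℕ} (W : Tensor n) (k : Fin K) : ℕ := (unfolding W k).rank

/-- The trace norm of a matrix: the sum of its non-zero singular values. -/
def traceNorm {α β : Type} [Fintype α] [Fintype β] [DecidableEq β] (A : Matrix α β ℝ) : ℝ :=
  (Matrix.toEuclideanLin A).singularValues.sum fun _ s => s

/-- The scaled overlapped trace norm. -/
def soverlapNorm {K : ℕ} {n : Fin K → ℕ} (W : Tensor n) : ℝ :=
  ∑ k, 1 / √(n k : ℝ) * traceNorm (unfolding W k)

/-- The expected risk of `W` for the loss `l` when `(X, y)` has law `μ`. -/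
def risk {K : ℕ} {n : Fin K → ℕ} {Y : Set ℝ} (l : ℝ → Y → ℝ) (μ : Measure (Tensor n × Y))
    (W : Tensor n) : ℝ :=
  ∫ z, l (tensorInner W z.1) z.2 ∂μ

/-- The empirical risk of `W` for the loss `l` on the training sample `z`. -/
def empRisk {K : ℕ} {n : Fin K → ℕ} {Y : Set ℝ} {m : ℕ} (l : ℝ → Y → ℝ)
    (z : Fin m → Tensor n × Y) (W : Tensor n) : ℝ :=
  1 / (m : ℝ) * ∑ i, l (tensorInner W (z i).1) (z i).2

/-- `W` minimizes `F` subject to `‖W‖_soverlap ≤ B₀`. -/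
def IsConstrainedMin {K : ℕ} {n : Fin K → ℕ} (F : Tensor n → ℝ) (B₀ : ℝ) (W : Tensor n) : Prop :=
  soverlapNorm W ≤ B₀ ∧ ∀ V : Tensor n, soverlapNorm V ≤ B₀ → F W ≤ F V

/-- The standard Gaussian law on tensors: the entries are independent `𝒩(0, 1)` variables. -/
def stdGaussianTensor {K : ℕ} (n : Fin K → ℕ) : Measure (Tensor n) :=
  Measure.pi fun _ => gaussianReal 0 1

/-- With probability at least `1 - δ` over an i.i.d. sample of size `m` from `μ`, every minimizer
`W'` of the empirical risk subject to `‖W'‖_soverlap ≤ B₀` satisfies `R(W') - R(W₀) ≤ ε`. -/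
def ExcessRiskBound {K : ℕ} {n : Fin K → ℕ} {Y : Set ℝ} (l : ℝ → Y → ℝ)
    (μ : Measure (Tensor n × Y)) (m : ℕ) (B₀ : ℝ) (W₀ : Tensor n) (δ ε : ℝ) : Prop :=
  ∃ E : Set (Fin m → Tensor n × Y), MeasurableSet E ∧
    ENNReal.ofReal (1 - δ) ≤ Measure.pi (fun _ : Fin m => μ) E ∧
    ∀ z ∈ E, ∀ W' : Tensor n, IsConstrainedMin (empRisk l z) B₀ W' → risk l μ W' - risk l μ W₀ ≤ ε

end

end TensorRisk

/-! (i) is Cauchy–Schwarz on the nonzero singular values of each unfolding, whose squares sum to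
`‖W‖_F²`.

For (ii), put `S = ∑ 1/√n_k` and `D = min_k (n_k + √N)`. By minimality, the excess risk of an
empirical minimizer is at most its `deviation`, so it suffices to bound the supremum of `deviation`
over the ball. Everything runs through exponential moments of that supremum.

Symmetrization, contraction and the symmetry of the Gaussian law replace each summand by the linear
Gaussian process `⟨W - W₀, X⟩` (`lintegral_eexp_iSup_excessLoss_le`); `lintegral_eexp_iSup_sum_le`
does this for the whole sample. Duality bounds `⟨W, G⟩` by `(B₀/S) max_k ‖G_(k)‖_op`, and nets bound
the maximum by four times a maximum over at most `exp (5 (S D)²)` rank-one tensors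
(`exists_finset_tensorInner_le`). Hence the exponential moment at `c` is at most `exp (5 (S D)² + c²
s² / 2)` with `s = 16 Λ (B₀/S) / √m`. Optimizing in `c` gives the main term, of order `s S D`, where
`S` cancels.

In (a) this moment bounds the mean of the supremum and McDiarmid's inequality adds the fluctuation.
In (b) the Chernoff bound is applied to it directly: the fluctuation is of order `s`, and `B₀/S ≤
ρ`, as a tensor with a single nonzero entry shows. Finite families suffice because the risks are
continuous and the ball is separable. -/

namespace LinearMap

/-! ### Singular values through the eigenvectors of `T* T` -/

variable {E F : Type*} [NormedAddCommGroup E] [InnerProductSpace ℝ E] [FiniteDimensional ℝ E]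
  [NormedAddCommGroup F] [InnerProductSpace ℝ F] [FiniteDimensional ℝ F]

theorem norm_apply_eigenvectorBasis (T : E →ₗ[ℝ] F) (i : Fin (Module.finrank ℝ E)) :
    ‖T (T.isSymmetric_adjoint_comp_self.eigenvectorBasis rfl i)‖ = T.singularValues i := by
  have h : ‖T (T.isSymmetric_adjoint_comp_self.eigenvectorBasis rfl i)‖ ^ 2
      = T.singularValues i ^ 2 := by
    rw [sq_singularValues_fin T rfl i, ← real_inner_self_eq_norm_sq, ← LinearMap.adjoint_inner_left,
      ← LinearMap.comp_apply, IsSymmetric.apply_eigenvectorBasis, RCLike.ofReal_real_eq_id,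
      id_eq, inner_smul_left, real_inner_self_eq_norm_sq, OrthonormalBasis.norm_eq_one]
    simp
  exact (sq_eq_sq₀ (norm_nonneg _) (T.singularValues_nonneg i)).1 h

theorem sum_singularValues_eq (T : E →ₗ[ℝ] F) {g : ℝ → ℝ} (hg : g 0 = 0) :
    (T.singularValues.sum fun _ s => g s) =
      ∑ i : Fin (Module.finrank ℝ E), g (T.singularValues i) := by
  rw [Finset.sum_fin_eq_sum_range]
  rw [Finsupp.sum_of_support_subset (s := Finset.range (Module.finrank ℝ E)) _ _ _ (by simp [hg])]
  · refine Finset.sum_congr rfl fun i hi => ?_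
    simp [Finset.mem_range.1 hi]
  · rw [support_singularValues]
    exact Finset.range_subset_range.2 (LinearMap.finrank_range_le T)

/-- Both sides are the trace of `T* U`, which does not see the basis. -/
theorem sum_inner_apply_orthonormalBasis {ι κ : Type*} [Fintype ι] [Fintype κ] (T U : E →ₗ[ℝ] F)
    (b : OrthonormalBasis ι ℝ E) (c : OrthonormalBasis κ ℝ E) :
    ∑ i, inner ℝ (T (b i)) (U (b i)) = ∑ i, inner ℝ (T (c i)) (U (c i)) := by
  classical
  have h : ∀ {ν : Type _} [Fintype ν] (b : OrthonormalBasis ν ℝ E),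
      ∑ i, inner ℝ (T (b i)) (U (b i)) = LinearMap.trace ℝ E (adjoint T ∘ₗ U) := by
    intro ν _ b
    rw [trace_eq_sum_inner _ b]
    simp [LinearMap.adjoint_inner_right]
  rw [h b, trace_eq_sum_inner _ c]
  simp [LinearMap.adjoint_inner_right]

end LinearMap

namespace TensorRisk

/-! ### Trace norm of a matrix: duality and the rank bound -/

section Matrix

variable {α β : Type} [Fintype α] [Fintype β] [DecidableEq β]

theorem sum_inner_toEuclideanLin (A M : Matrix α β ℝ) {ι : Type} [Fintype ι]
    (b : OrthonormalBasis ι ℝ (EuclideanSpace ℝ β)) :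
    ∑ i, inner ℝ (Matrix.toEuclideanLin A (b i)) (Matrix.toEuclideanLin M (b i)) =
      ∑ x, ∑ y, A x y * M x y := by
  rw [LinearMap.sum_inner_apply_orthonormalBasis _ _ b (EuclideanSpace.basisFun β ℝ),
    Finset.sum_comm]
  refine Finset.sum_congr rfl fun y _ => ?_
  simp [PiLp.inner_apply, mul_comm]

/-- Trace/operator norm duality. Computed in the right singular basis `v_i` of `A`, the pairing is
`∑ ⟨A v_i, M v_i⟩`, where `‖A v_i‖` is the `i`-th singular value and `‖M v_i‖ ≤ c`. -/
theorem sum_mul_le_traceNorm_mul (A M : Matrix α β ℝ) {c : ℝ}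
    (hc : ∀ v, ‖Matrix.toEuclideanLin M v‖ ≤ c * ‖v‖) :
    ∑ x, ∑ y, A x y * M x y ≤ traceNorm A * c := by
  set T := Matrix.toEuclideanLin A
  rw [traceNorm, T.sum_singularValues_eq (g := fun s => s) rfl, Finset.sum_mul,
    ← sum_inner_toEuclideanLin A M (T.isSymmetric_adjoint_comp_self.eigenvectorBasis rfl)]
  refine Finset.sum_le_sum fun i _ => (real_inner_le_norm _ _).trans ?_
  rw [T.norm_apply_eigenvectorBasis]
  refine mul_le_mul_of_nonneg_left ((hc _).trans ?_) (T.singularValues_nonneg i)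
  simp

theorem traceNorm_nonneg (A : Matrix α β ℝ) : 0 ≤ traceNorm A :=
  Finset.sum_nonneg fun _ _ => LinearMap.singularValues_nonneg _ _

theorem sum_sq_singularValues (A : Matrix α β ℝ) :
    ((Matrix.toEuclideanLin A).singularValues.sum fun _ s => s ^ 2) = ∑ x, ∑ y, A x y * A x y := by
  set T := Matrix.toEuclideanLin A
  rw [T.sum_singularValues_eq (g := fun s => s ^ 2) (by simp),
    ← sum_inner_toEuclideanLin A A (T.isSymmetric_adjoint_comp_self.eigenvectorBasis rfl)]
  refine Finset.sum_congr rfl fun i _ => ?_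
  rw [real_inner_self_eq_norm_sq, T.norm_apply_eigenvectorBasis]

/-- Cauchy–Schwarz on the support of the singular values, which has `rank A` elements. -/
theorem traceNorm_le_sqrt_rank_mul (A : Matrix α β ℝ) :
    traceNorm A ≤ √(A.rank : ℝ) * √(∑ x, ∑ y, A x y * A x y) := by
  set T := Matrix.toEuclideanLin A with hT
  rw [← Real.sqrt_mul (by positivity), ← sum_sq_singularValues]
  refine Real.le_sqrt_of_sq_le ?_
  have h := sq_sum_le_card_mul_sum_sq (s := T.singularValues.support)
    (f := fun i => T.singularValues i)
  rw [T.card_support_singularValues] at h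
  have hr : A.rank = Module.finrank ℝ T.range := by
    rw [hT, Matrix.toEuclideanLin_eq_toLin_orthonormal]
    exact A.rank_eq_finrank_range_toLin _ _
  rw [hr]
  exact h

end Matrix

/-! ### The scaled overlapped trace norm and its dual bound -/

section Tensor

variable {K : ℕ} {n : Fin K → ℕ}

theorem sum_unfolding (W G : Tensor n) (k : Fin K) :
    ∑ x, ∑ y, unfolding W k x y * unfolding G k x y = tensorInner W G := by
  rw [← Fintype.sum_prod_type', tensorInner]
  exact (Equiv.piSplitAt k fun j => Fin (n j)).symm.sum_comp fun i => W i * G i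

theorem traceNorm_unfolding_le (W : Tensor n) (k : Fin K) :
    traceNorm (unfolding W k) ≤ √(modeRank W k : ℝ) * frobNorm W := by
  have h := traceNorm_le_sqrt_rank_mul (unfolding W k)
  rwa [sum_unfolding] at h

theorem soverlapNorm_le_sum_sqrt_mul_frobNorm (W : Tensor n) :
    soverlapNorm W ≤ (∑ k, √((modeRank W k : ℝ) / (n k : ℝ))) * frobNorm W := by
  rw [soverlapNorm, Finset.sum_mul]
  refine Finset.sum_le_sum fun k _ => ?_
  calc _ ≤ 1 / √(n k : ℝ) * (√(modeRank W k : ℝ) * frobNorm W) := by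
        gcongr; exact traceNorm_unfolding_le W k
    _ = _ := by rw [Real.sqrt_div (by positivity)]; ring

/-- The sum of the weights in the scaled overlapped trace norm. -/
noncomputable def weightSum (n : Fin K → ℕ) : ℝ := ∑ k, 1 / √(n k : ℝ)

theorem frobNorm_single (i : (k : Fin K) → Fin (n k)) {ρ : ℝ} (hρ : 0 ≤ ρ) :
    frobNorm (Pi.single i ρ : Tensor n) = ρ := by
  classical
  simp [frobNorm, tensorInner, Pi.single_apply, Real.sqrt_mul_self hρ]

/-- Each unfolding is the outer product of two coordinate vectors. -/
theorem modeRank_single_le (i : (k : Fin K) → Fin (n k)) (ρ : ℝ) (k : Fin K) :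
    modeRank (Pi.single i ρ : Tensor n) k ≤ 1 := by
  classical
  have h : unfolding (Pi.single i ρ : Tensor n) k =
      Matrix.vecMulVec (Pi.single (i k) ρ) (Pi.single (fun j : {j : Fin K // j ≠ k} => i j) 1) := by
    ext a f
    have hi : (Equiv.piSplitAt k fun j => Fin (n j)).symm (a, f) = i ↔
        a = i k ∧ f = fun j : {j : Fin K // j ≠ k} => i j := by
      rw [Equiv.symm_apply_eq, Prod.ext_iff]; rfl
    simp only [unfolding, Matrix.of_apply, Matrix.vecMulVec_apply, Pi.single_apply, hi]
    by_cases h1 : a = i k <;> by_cases h2 : f = fun j : {j : Fin K // j ≠ k} => i j <;>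
      simp [h1, h2]
  rw [modeRank, h]
  exact Matrix.rank_vecMulVec_le _ _

theorem soverlapNorm_single_le (i : (k : Fin K) → Fin (n k)) {ρ : ℝ} (hρ : 0 ≤ ρ) :
    soverlapNorm (Pi.single i ρ : Tensor n) ≤ weightSum n * ρ := by
  refine (soverlapNorm_le_sum_sqrt_mul_frobNorm _).trans ?_
  rw [frobNorm_single i hρ, weightSum]
  refine mul_le_mul_of_nonneg_right (Finset.sum_le_sum fun k _ => ?_) hρ
  rw [← Real.sqrt_one, ← Real.sqrt_div zero_le_one]
  have : (modeRank (Pi.single i ρ : Tensor n) k : ℝ) ≤ 1 := by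
    exact_mod_cast modeRank_single_le i ρ k
  gcongr

theorem soverlapNorm_nonneg (W : Tensor n) : 0 ≤ soverlapNorm W :=
  Finset.sum_nonneg fun _ _ => mul_nonneg (by positivity) (traceNorm_nonneg _)

theorem weightSum_pos (hK : 0 < K) (hn : ∀ k, 0 < n k) : 0 < weightSum n := by
  have : Nonempty (Fin K) := ⟨⟨0, hK⟩⟩
  refine Finset.sum_pos (fun k _ => ?_) Finset.univ_nonempty
  have : (0 : ℝ) < n k := by exact_mod_cast hn k
  positivity

/-- A Frobenius bound on the ball of radius `B₀` is at least `B₀ / weightSum n`. -/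
theorem div_weightSum_le (hK : 0 < K) (hn : ∀ k, 0 < n k) {B₀ ρ : ℝ} (hB₀ : 0 ≤ B₀)
    (hρ : ∀ W : Tensor n, soverlapNorm W ≤ B₀ → frobNorm W ≤ ρ) : B₀ / weightSum n ≤ ρ := by
  have hS := weightSum_pos hK hn
  have h0 : 0 ≤ B₀ / weightSum n := by positivity
  have h := hρ (Pi.single (fun k => ⟨0, hn k⟩) (B₀ / weightSum n))
    ((soverlapNorm_single_le _ h0).trans_eq (by field_simp))
  rwa [frobNorm_single _ h0] at h

/-- Duality between the scaled overlapped trace norm and the operator norms of the unfoldings. -/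
theorem tensorInner_le_of_unfolding_le (hK : 0 < K) (hn : ∀ k, 0 < n k) {W G : Tensor n}
    {B₀ c : ℝ} (hW : soverlapNorm W ≤ B₀) (hc0 : 0 ≤ c)
    (hc : ∀ k v, ‖Matrix.toEuclideanLin (unfolding G k) v‖ ≤ c * ‖v‖) :
    tensorInner W G ≤ B₀ / weightSum n * c := by
  have hS := weightSum_pos hK hn
  rw [div_mul_eq_mul_div, le_div_iff₀ hS]
  -- All unfoldings give the same inner product, so it can be averaged over the modes with weights
  -- `1/√n_k`; duality in each mode then reassembles the norm of `W`.
  calc tensorInner W G * weightSum n = ∑ k, 1 / √(n k : ℝ) * tensorInner W G := by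
        rw [weightSum, Finset.mul_sum]; simp_rw [mul_comm]
    _ ≤ ∑ k, 1 / √(n k : ℝ) * (traceNorm (unfolding W k) * c) := by
        refine Finset.sum_le_sum fun k _ => mul_le_mul_of_nonneg_left ?_ (by positivity)
        rw [← sum_unfolding W G k]
        exact sum_mul_le_traceNorm_mul _ _ (hc k)
    _ = soverlapNorm W * c := by
        rw [soverlapNorm, Finset.sum_mul]; simp_rw [mul_assoc]
    _ ≤ B₀ * c := by gcongr

end Tensor

/-! ### Nets and operator norms of unfoldings -/

section NetBounds

section Net

variable {E F : Type*} [NormedAddCommGroup E] [InnerProductSpace ℝ E] [FiniteDimensional ℝ E]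
  [NormedAddCommGroup F] [InnerProductSpace ℝ F]

/-- `s` is a finite `1/2`-net of the unit ball, contained in the unit ball. -/
def IsHalfNet {V : Type*} [NormedAddCommGroup V] (s : Finset V) : Prop :=
  (∀ x ∈ s, ‖x‖ ≤ 1) ∧ ∀ v : V, ‖v‖ ≤ 1 → ∃ x ∈ s, ‖v - x‖ ≤ 1 / 2

variable (E) in
-- A `1/2`-separated subset of the unit ball of maximal cardinality is a net. Doubling it gives
-- `1`-separated points in the ball of radius `2`, the normalization of the `5 ^ dim` packing bound.
theorem exists_isHalfNet : ∃ s : Finset E, IsHalfNet s ∧ s.card ≤ 5 ^ Module.finrank ℝ E := by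
  classical
  let P : Finset E → Prop := fun s =>
    (∀ x ∈ s, ‖x‖ ≤ 1) ∧ ∀ x ∈ s, ∀ y ∈ s, x ≠ y → 1 / 2 ≤ ‖x - y‖
  have hcard : ∀ s, P s → s.card ≤ 5 ^ Module.finrank ℝ E := by
    intro s hs
    have hinj : Function.Injective fun x : E => (2 : ℝ) • x := smul_right_injective E two_ne_zero
    rw [← Finset.card_image_of_injective s hinj]
    refine Besicovitch.card_le_of_separated _ ?_ ?_
    · simp only [Finset.forall_mem_image]
      intro x hx
      rw [norm_smul, Real.norm_two]
      linarith [hs.1 x hx]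
    · simp only [Finset.forall_mem_image]
      intro x hx y hy hxy
      rw [← smul_sub, norm_smul, Real.norm_two]
      linarith [hs.2 x hx y hy fun h => hxy (by rw [h])]
  let C : Set ℕ := {k | ∃ s, P s ∧ s.card = k}
  have hC : BddAbove C := ⟨_, fun k ⟨s, hs, hk⟩ => hk ▸ hcard s hs⟩
  obtain ⟨s, hs, hmax⟩ : sSup C ∈ C := Nat.sSup_mem ⟨0, ∅, by simp [P], rfl⟩ hC
  refine ⟨s, ⟨hs.1, fun v hv => ?_⟩, hcard s hs⟩
  by_contra! hfar
  have hvs : v ∉ s := fun h => by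
    have := hfar v h
    norm_num at this
  have hP : P (insert v s) := by
    refine ⟨?_, ?_⟩
    · simpa [hv] using hs.1
    · intro x hx y hy hxy
      rcases Finset.mem_insert.1 hx with rfl | hx' <;> rcases Finset.mem_insert.1 hy with rfl | hy'
      · exact absurd rfl hxy
      · exact (hfar y hy').le
      · rw [norm_sub_rev]; exact (hfar x hx').le
      · exact hs.2 x hx' y hy' hxy
  have := le_csSup hC ⟨_, hP, rfl⟩
  rw [Finset.card_insert_of_notMem hvs] at this
  omega

theorem IsHalfNet.nonempty {V : Type*} [NormedAddCommGroup V] {s : Finset V} (hs : IsHalfNet s) :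
    s.Nonempty := by
  obtain ⟨x, hx, -⟩ := hs.2 0 (by simp)
  exact ⟨x, hx⟩

/-- Replacing the direction of `w` by a net point loses at most `‖w‖ / 2`. -/
theorem IsHalfNet.norm_le {t : Finset F} (ht : IsHalfNet t) {w : F} {c : ℝ}
    (h : ∀ y ∈ t, inner ℝ y w ≤ c) : ‖w‖ ≤ 2 * c := by
  obtain ⟨y, hy, hyw⟩ := ht.2 (‖w‖⁻¹ • w) (by
    rw [norm_smul, norm_inv, norm_norm]; exact inv_mul_le_one)
  have h1 : inner ℝ (‖w‖⁻¹ • w) w = ‖w‖ := by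
    rw [real_inner_smul_left, real_inner_self_eq_norm_sq]
    by_cases hw : ‖w‖ = 0
    · simp [hw]
    · field_simp
  have h2 : inner ℝ (‖w‖⁻¹ • w - y) w ≤ 1 / 2 * ‖w‖ :=
    (real_inner_le_norm _ _).trans (by gcongr)
  rw [inner_sub_left, h1] at h2
  linarith [h y hy]

/-- Approximating a unit vector by the net gives `‖T‖ ≤ c + ‖T‖ / 2`, which is solved for `‖T‖`. -/
theorem IsHalfNet.norm_apply_le {s : Finset E} (hs : IsHalfNet s) (T : E →ₗ[ℝ] F) {c : ℝ}
    (h : ∀ x ∈ s, ‖T x‖ ≤ c) (v : E) : ‖T v‖ ≤ 2 * c * ‖v‖ := by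
  obtain ⟨x₀, hx₀⟩ := hs.nonempty
  have hc : 0 ≤ c := (norm_nonneg _).trans (h x₀ hx₀)
  set T' := LinearMap.toContinuousLinearMap T
  have hT : ∀ v, T' v = T v := fun _ => rfl
  have h1 : ‖T'‖ ≤ c + 1 / 2 * ‖T'‖ := by
    refine ContinuousLinearMap.opNorm_le_of_unit_norm (by positivity) fun v hv => ?_
    obtain ⟨x, hx, hvx⟩ := hs.2 v hv.le
    calc ‖T' v‖ = ‖T' x + T' (v - x)‖ := by rw [← map_add]; simp
      _ ≤ ‖T' x‖ + ‖T' (v - x)‖ := norm_add_le _ _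
      _ ≤ c + ‖T'‖ * (1 / 2) := by
        refine add_le_add (h x hx) ((T'.le_opNorm _).trans (by gcongr))
      _ = _ := by ring
  rw [← hT]
  refine (T'.le_opNorm v).trans ?_
  gcongr
  linarith

theorem IsHalfNet.norm_apply_le_of_inner_le {s : Finset E} {t : Finset F} (hs : IsHalfNet s)
    (ht : IsHalfNet t) (T : E →ₗ[ℝ] F) {c : ℝ}
    (h : ∀ x ∈ s, ∀ y ∈ t, inner ℝ y (T x) ≤ c) (v : E) : ‖T v‖ ≤ 4 * c * ‖v‖ := by
  have := hs.norm_apply_le T (c := 2 * c) (fun x hx => ht.norm_le (h x hx)) v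
  linarith

end Net

variable {K : ℕ} {n : Fin K → ℕ}

/-- The tensor whose mode-`k` unfolding is the rank-one matrix `y xᵀ`. -/
def rankOne (k : Fin K) (x : EuclideanSpace ℝ ((j : {j : Fin K // j ≠ k}) → Fin (n j)))
    (y : EuclideanSpace ℝ (Fin (n k))) : Tensor n :=
  fun i => y (i k) * x (fun j => i j)

theorem unfolding_rankOne (k : Fin K)
    (x : EuclideanSpace ℝ ((j : {j : Fin K // j ≠ k}) → Fin (n j)))
    (y : EuclideanSpace ℝ (Fin (n k))) (a : Fin (n k))
    (f : (j : {j : Fin K // j ≠ k}) → Fin (n j)) :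
    unfolding (rankOne k x y) k a f = y a * x f := by
  obtain ⟨i, hi⟩ := (Equiv.piSplitAt k fun j => Fin (n j)).surjective (a, f)
  obtain ⟨rfl, rfl⟩ := Prod.ext_iff.1 hi
  exact unfolding_apply _ _ _

theorem tensorInner_rankOne (k : Fin K)
    (x : EuclideanSpace ℝ ((j : {j : Fin K // j ≠ k}) → Fin (n j)))
    (y : EuclideanSpace ℝ (Fin (n k))) (G : Tensor n) :
    tensorInner (rankOne k x y) G = inner ℝ y (Matrix.toEuclideanLin (unfolding G k) x) := by
  rw [← sum_unfolding _ _ k, PiLp.inner_apply]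
  refine Finset.sum_congr rfl fun a _ => ?_
  simp only [unfolding_rankOne, Matrix.toLpLin_apply, Matrix.mulVec, dotProduct,
    RCLike.inner_apply, conj_trivial, Finset.sum_mul]
  exact Finset.sum_congr rfl fun f _ => by ring

theorem tensorInner_rankOne_self (k : Fin K)
    (x : EuclideanSpace ℝ ((j : {j : Fin K // j ≠ k}) → Fin (n j)))
    (y : EuclideanSpace ℝ (Fin (n k))) :
    tensorInner (rankOne k x y) (rankOne k x y) = ‖y‖ ^ 2 * ‖x‖ ^ 2 := by
  rw [← sum_unfolding _ _ k, EuclideanSpace.norm_sq_eq, EuclideanSpace.norm_sq_eq,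
    Finset.sum_mul_sum]
  refine Finset.sum_congr rfl fun a _ => Finset.sum_congr rfl fun f _ => ?_
  rw [unfolding_rankOne, Real.norm_eq_abs, Real.norm_eq_abs, sq_abs, sq_abs]
  ring

/-- Finitely many tensors control the operator norms of all the unfoldings. -/
theorem exists_finset_unfolding_le (hK : 0 < K) (n : Fin K → ℕ) :
    ∃ 𝒯 : Finset (Tensor n), 𝒯.Nonempty ∧
      𝒯.card ≤ ∑ k, 5 ^ (Fintype.card ((j : {j : Fin K // j ≠ k}) → Fin (n j)) + n k) ∧
      (∀ T ∈ 𝒯, tensorInner T T ≤ 1) ∧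
      ∀ (G : Tensor n) (c : ℝ), (∀ T ∈ 𝒯, tensorInner T G ≤ c) →
        ∀ k v, ‖Matrix.toEuclideanLin (unfolding G k) v‖ ≤ 4 * c * ‖v‖ := by
  classical
  choose s hs hsc using fun k : Fin K =>
    exists_isHalfNet (EuclideanSpace ℝ ((j : {j : Fin K // j ≠ k}) → Fin (n j)))
  choose t ht htc using fun k : Fin K => exists_isHalfNet (EuclideanSpace ℝ (Fin (n k)))
  refine ⟨Finset.univ.biUnion fun k => Finset.image₂ (rankOne k) (s k) (t k), ?_, ?_, ?_, ?_⟩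
  · exact Finset.Nonempty.biUnion ⟨⟨0, hK⟩, Finset.mem_univ _⟩ fun k _ =>
      (hs k).nonempty.image₂ (ht k).nonempty
  · refine Finset.card_biUnion_le.trans (Finset.sum_le_sum fun k _ => ?_)
    refine (Finset.card_image₂_le _ _ _).trans ?_
    rw [pow_add]
    refine Nat.mul_le_mul ((hsc k).trans_eq ?_) ((htc k).trans_eq ?_) <;> simp
  · intro T hT
    simp only [Finset.mem_biUnion, Finset.mem_image₂] at hT
    obtain ⟨k, -, x, hx, y, hy, rfl⟩ := hT
    rw [tensorInner_rankOne_self]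
    exact mul_le_one₀ (pow_le_one₀ (norm_nonneg _) ((ht k).1 y hy)) (by positivity)
      (pow_le_one₀ (norm_nonneg _) ((hs k).1 x hx))
  · intro G c hG k v
    refine (hs k).norm_apply_le_of_inner_le (ht k) _ (fun x hx y hy => ?_) v
    rw [← tensorInner_rankOne]
    exact hG _ (Finset.mem_biUnion.2 ⟨k, Finset.mem_univ k, Finset.mem_image₂_of_mem hx hy⟩)

/-- The dimensional factor `min_k (n_k + √N)` of the risk bound. -/
noncomputable def dimFactor (n : Fin K → ℕ) : ℝ := ⨅ k, ((n k : ℝ) + √((∏ j, n j : ℕ) : ℝ))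

theorem sqrt_prod_le_dimFactor (hK : 0 < K) (n : Fin K → ℕ) :
    √((∏ j, n j : ℕ) : ℝ) ≤ dimFactor n := by
  have : Nonempty (Fin K) := ⟨⟨0, hK⟩⟩
  exact le_ciInf fun k => le_add_of_nonneg_left (by positivity)

theorem card_rest_mul (n : Fin K → ℕ) (k : Fin K) :
    n k * Fintype.card ((j : {j : Fin K // j ≠ k}) → Fin (n j)) = ∏ j, n j := by
  have := Fintype.card_congr (Equiv.piSplitAt k fun j => Fin (n j))
  rw [Fintype.card_prod, Fintype.card_fin] at this
  rw [← this]
  simp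

theorem inv_sqrt_le_weightSum (n : Fin K → ℕ) (k : Fin K) : 1 / √(n k : ℝ) ≤ weightSum n :=
  Finset.single_le_sum (f := fun k => 1 / √(n k : ℝ)) (fun _ _ => by positivity)
    (Finset.mem_univ k)

theorem card_rest_le (hK : 0 < K) (hn : ∀ k, 0 < n k) (k : Fin K) :
    (Fintype.card ((j : {j : Fin K // j ≠ k}) → Fin (n j)) : ℝ) ≤
      (weightSum n * dimFactor n) ^ 2 := by
  have hk : (0 : ℝ) < n k := by exact_mod_cast hn k
  have h : (n k : ℝ) * Fintype.card ((j : {j : Fin K // j ≠ k}) → Fin (n j)) =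
      ((∏ j, n j : ℕ) : ℝ) := by exact_mod_cast card_rest_mul n k
  calc _ = (1 / √(n k : ℝ) * √((∏ j, n j : ℕ) : ℝ)) ^ 2 := by
        rw [mul_pow, div_pow, Real.sq_sqrt hk.le, Real.sq_sqrt (by positivity), ← h]
        field_simp
    _ ≤ _ := by
        gcongr
        · exact (weightSum_pos hK hn).le
        · exact inv_sqrt_le_weightSum n k
        · exact sqrt_prod_le_dimFactor hK n

/-- If there is another mode `j`, then `n_k` divides `N / n_j`. If `K = 1`, the summand `n_k` of the
dimensional factor is needed: `n_k = (n_k / √n_k)²`. -/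
theorem dim_le (hK : 0 < K) (hn : ∀ k, 0 < n k) (k : Fin K) :
    (n k : ℝ) ≤ (weightSum n * dimFactor n) ^ 2 := by
  by_cases h : ∃ j, j ≠ k
  · obtain ⟨j, hj⟩ := h
    refine le_trans ?_ (card_rest_le hK hn j)
    norm_cast
    rw [Fintype.card_pi]
    simp only [Fintype.card_fin]
    exact Nat.le_of_dvd (Finset.prod_pos fun i _ => hn _)
      (Finset.dvd_prod_of_mem (fun i : {l : Fin K // l ≠ j} => n i)
        (Finset.mem_univ ⟨k, hj.symm⟩))
  · push Not at h
    have : Nonempty (Fin K) := ⟨k⟩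
    have hk : (0 : ℝ) < n k := by exact_mod_cast hn k
    have hM : (n k : ℝ) ≤ dimFactor n :=
      le_ciInf fun j => by rw [h j]; exact le_add_of_nonneg_right (by positivity)
    calc (n k : ℝ) = (1 / √(n k : ℝ) * n k) ^ 2 := by
          rw [mul_pow, div_pow, Real.sq_sqrt hk.le]; field_simp
      _ ≤ _ := by
        gcongr
        · exact (weightSum_pos hK hn).le
        · exact inv_sqrt_le_weightSum n k

/-- Every `n_k ≤ N`, so the weights sum to at least `K / √N`. -/
theorem order_le (hK : 0 < K) (hn : ∀ k, 0 < n k) :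
    (K : ℝ) ≤ (weightSum n * dimFactor n) ^ 2 := by
  have hN : (0 : ℝ) < ((∏ j, n j : ℕ) : ℝ) := by exact_mod_cast Finset.prod_pos fun k _ => hn k
  have h1 : (K : ℝ) ≤ weightSum n * dimFactor n := by
    calc (K : ℝ) = (∑ _k : Fin K, 1 / √((∏ j, n j : ℕ) : ℝ)) * √((∏ j, n j : ℕ) : ℝ) := by
          rw [Finset.sum_const, Finset.card_univ, Fintype.card_fin, nsmul_eq_mul]
          field_simp
      _ ≤ weightSum n * dimFactor n := by
        have hS := (weightSum_pos hK hn).le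
        refine mul_le_mul (Finset.sum_le_sum fun k _ => ?_) (sqrt_prod_le_dimFactor hK n)
          (by positivity) hS
        have hk : (0 : ℝ) < n k := by exact_mod_cast hn k
        have : n k ≤ ∏ j, n j := Nat.le_of_dvd (Finset.prod_pos fun i _ => hn _)
          (Finset.dvd_prod_of_mem n (Finset.mem_univ k))
        gcongr
  have h2 : (1 : ℝ) ≤ K := by exact_mod_cast hK
  nlinarith

/-- With `X = (S D)²`, each exponent is at most `2 X` and `5 ≤ e²`, so each term is at most
`e^{4X}`; the number `K ≤ X` of terms costs one more `e^X`. -/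
theorem sum_five_pow_le (hK : 0 < K) (hn : ∀ k, 0 < n k) :
    ((∑ k, 5 ^ (Fintype.card ((j : {j : Fin K // j ≠ k}) → Fin (n j)) + n k) : ℕ) : ℝ) ≤
      Real.exp (5 * (weightSum n * dimFactor n) ^ 2) := by
  set X := (weightSum n * dimFactor n) ^ 2
  have h5 : (5 : ℝ) ≤ Real.exp 2 := by
    have := Real.exp_one_gt_d9
    have h : Real.exp 2 = Real.exp 1 ^ 2 := by rw [← Real.exp_nat_mul]; norm_num
    rw [h]; nlinarith
  push_cast
  calc _ ≤ ∑ _k : Fin K, Real.exp (4 * X) := by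
        refine Finset.sum_le_sum fun k _ => ?_
        calc (5 : ℝ) ^ (Fintype.card ((j : {j : Fin K // j ≠ k}) → Fin (n j)) + n k)
            ≤ Real.exp 2 ^ (Fintype.card ((j : {j : Fin K // j ≠ k}) → Fin (n j)) + n k) := by
              gcongr
          _ ≤ _ := by
            rw [← Real.exp_nat_mul, Real.exp_le_exp]
            push_cast
            linarith [card_rest_le hK hn k, dim_le hK hn k]
    _ = K * Real.exp (4 * X) := by simp
    _ ≤ Real.exp X * Real.exp (4 * X) := by
        gcongr
        linarith [order_le hK hn, Real.add_one_le_exp X]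
    _ = _ := by rw [← Real.exp_add]; ring_nf

/-- A finite family of tensors in the Frobenius unit ball that controls the inner products with all
the elements of a ball of the scaled overlapped trace norm. -/
theorem exists_finset_tensorInner_le (hK : 0 < K) (hn : ∀ k, 0 < n k) :
    ∃ 𝒯 : Finset (Tensor n),
      (𝒯.card : ℝ) ≤ Real.exp (5 * (weightSum n * dimFactor n) ^ 2) ∧
      (∀ T ∈ 𝒯, tensorInner T T ≤ 1) ∧
      ∀ G : Tensor n, ∃ T ∈ 𝒯, ∀ (W : Tensor n) (B₀ : ℝ), soverlapNorm W ≤ B₀ →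
        |tensorInner W G| ≤ B₀ / weightSum n * (4 * tensorInner T G) := by
  classical
  obtain ⟨𝒯, hne, hcard, hT, hG⟩ := exists_finset_unfolding_le hK n
  refine ⟨𝒯, le_trans (by exact_mod_cast hcard) (sum_five_pow_le hK hn), hT, fun G => ?_⟩
  -- The maximizer depends on `G` only, hence serves all `W` at once.
  obtain ⟨T, hTm, hmax⟩ := 𝒯.exists_max_image (fun T => tensorInner T G) hne
  refine ⟨T, hTm, fun W B₀ hW => ?_⟩
  have h1 := hG G _ hmax
  have h0 : 0 ≤ 4 * tensorInner T G := by
    simpa using (norm_nonneg _).trans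
      (h1 ⟨0, hK⟩ (EuclideanSpace.single (fun j => ⟨0, hn j⟩) 1))
  refine abs_le'.2 ⟨tensorInner_le_of_unfolding_le hK hn hW h0 h1, ?_⟩
  -- The lower bound uses that `-G` has the same operator norms as `G`.
  have h2 : -tensorInner W G = tensorInner W (-G) := by simp [tensorInner]
  rw [h2]
  refine tensorInner_le_of_unfolding_le hK hn hW h0 fun k v => ?_
  have h3 : unfolding (-G) k = -unfolding G k := rfl
  rw [h3, map_neg, LinearMap.neg_apply, norm_neg]
  exact h1 k v

end NetBounds

/-! ### Contraction principle -/

section Contraction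

/-- Convexity and monotonicity of `exp`: `P + Q ≥ A + B`, and `Q` lies below both `A` and `B`. -/
theorem exp_add_exp_le {A B P Q : ℝ} (h1 : Q ≤ A) (h2 : Q ≤ B) (h3 : B - Q ≤ P - A) :
    Real.exp A + Real.exp B ≤ Real.exp P + Real.exp Q := by
  have hB : Real.exp B = Real.exp Q * Real.exp (B - Q) := by rw [← Real.exp_add]; ring_nf
  have hP : Real.exp P = Real.exp A * Real.exp (P - A) := by rw [← Real.exp_add]; ring_nf
  have h4 : Real.exp (B - Q) ≤ Real.exp (P - A) := Real.exp_le_exp.2 h3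
  have h5 : 1 ≤ Real.exp (B - Q) := Real.one_le_exp (by linarith)
  have h6 : Real.exp Q ≤ Real.exp A := Real.exp_le_exp.2 h1
  rw [hB, hP]
  nlinarith [Real.exp_pos A, Real.exp_pos Q]

variable {ι : Type*}

/-- Here `j` and `k` are the maximizers on the left. If `t j` and `t k` have opposite signs, each
term is bounded separately by `|p| ≤ |t|`. If they have the same sign, the index with the larger
`|t|` is compared with one of `U`, `V` and the other index with the other, through `exp_add_exp_le`.
-/
theorem exp_add_exp_le_of_contraction {a p t : ι → ℝ} (h1 : ∀ j, |p j| ≤ |t j|)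
    (h2 : ∀ j k, |p j - p k| ≤ |t j - t k|) {U V : ℝ} (hU : ∀ i, a i + t i ≤ U)
    (hV : ∀ i, a i - t i ≤ V) {j k : ι} (hj : ∀ i, a i + p i ≤ a j + p j)
    (hk : ∀ i, a i - p i ≤ a k - p k) :
    Real.exp (a j + p j) + Real.exp (a k - p k) ≤ Real.exp U + Real.exp V := by
  wlog hpos : 0 ≤ t j generalizing t U V
  · have := this (t := fun i => -t i) (U := V) (V := U) (by simpa using h1)
      (fun j k => by
        rw [show -t j - -t k = -(t j - t k) by ring, abs_neg]
        exact h2 j k)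
      (fun i => by linarith [hV i]) (fun i => by linarith [hU i]) (by linarith)
    linarith
  obtain ⟨hj1, hj2⟩ := abs_le.1 (h1 j)
  obtain ⟨hk1, hk2⟩ := abs_le.1 (h1 k)
  rw [abs_of_nonneg hpos] at hj1 hj2
  have hUj := Real.exp_le_exp.2 (hU j)
  have hUk := Real.exp_le_exp.2 (hU k)
  have hVj := Real.exp_le_exp.2 (hV j)
  have hVk := Real.exp_le_exp.2 (hV k)
  rcases le_total (t k) 0 with hk0 | hk0
  · rw [abs_of_nonpos hk0] at hk1 hk2
    have e1 : Real.exp (a j + p j) ≤ Real.exp (a j + t j) := Real.exp_le_exp.2 (by linarith)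
    have e2 : Real.exp (a k - p k) ≤ Real.exp (a k - t k) := Real.exp_le_exp.2 (by linarith)
    linarith
  · rw [abs_of_nonneg hk0] at hk1 hk2
    obtain ⟨hd1, hd2⟩ := abs_le.1 (h2 j k)
    rcases le_total (t k) (t j) with h | h
    · rw [abs_of_nonneg (by linarith)] at hd1 hd2
      have := exp_add_exp_le (A := a j + p j) (B := a k - p k) (P := a j + t j) (Q := a k - t k)
        (by linarith [hj k]) (by linarith) (by linarith)
      linarith
    · rw [abs_of_nonpos (by linarith)] at hd1 hd2
      have := exp_add_exp_le (A := a k - p k) (B := a j + p j) (P := a k + t k) (Q := a j - t j)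
        (by linarith [hk j]) (by linarith) (by linarith)
      linarith

/-- The contraction principle for one Rademacher variable and the exponential function. -/
theorem exp_iSup_add_exp_iSup_le [Finite ι] [Nonempty ι] {a p t : ι → ℝ}
    (h1 : ∀ j, |p j| ≤ |t j|) (h2 : ∀ j k, |p j - p k| ≤ |t j - t k|) :
    Real.exp (⨆ j, (a j + p j)) + Real.exp (⨆ j, (a j - p j)) ≤
      Real.exp (⨆ j, (a j + t j)) + Real.exp (⨆ j, (a j - t j)) := by
  obtain ⟨j, hj⟩ := exists_eq_ciSup_of_finite (f := fun j => a j + p j)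
  obtain ⟨k, hk⟩ := exists_eq_ciSup_of_finite (f := fun j => a j - p j)
  rw [← hj, ← hk]
  refine exp_add_exp_le_of_contraction h1 h2
    (le_ciSup (f := fun j => a j + t j) (Set.finite_range _).bddAbove)
    (le_ciSup (f := fun j => a j - t j) (Set.finite_range _).bddAbove) ?_ ?_
  · rw [hj]; exact le_ciSup (f := fun j => a j + p j) (Set.finite_range _).bddAbove
  · rw [hk]; exact le_ciSup (f := fun j => a j - p j) (Set.finite_range _).bddAbove

end Contraction

/-! ### Exponential moments in `ℝ≥0∞` -/

/-- The exponential function with values in `ℝ≥0∞`. -/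
noncomputable def eexp (x : ℝ) : ℝ≥0∞ := ENNReal.ofReal (Real.exp x)

theorem eexp_mono : Monotone eexp := fun _ _ h => ENNReal.ofReal_le_ofReal (Real.exp_le_exp.2 h)

@[fun_prop]
theorem measurable_eexp : Measurable eexp :=
  ENNReal.measurable_ofReal.comp Real.measurable_exp

theorem eexp_add (x y : ℝ) : eexp (x + y) = eexp x * eexp y := by
  rw [eexp, Real.exp_add, ENNReal.ofReal_mul (Real.exp_pos x).le]; rfl

theorem eexp_sum {ι : Type*} (s : Finset ι) (f : ι → ℝ) :
    eexp (∑ i ∈ s, f i) = ∏ i ∈ s, eexp (f i) := by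
  rw [eexp, Real.exp_sum, ENNReal.ofReal_prod_of_nonneg fun i _ => (Real.exp_pos _).le]; rfl

theorem eexp_pos (x : ℝ) : 0 < eexp x := ENNReal.ofReal_pos.2 (Real.exp_pos x)

theorem eexp_ne_top (x : ℝ) : eexp x ≠ ∞ := ENNReal.ofReal_ne_top

/-- Jensen's inequality for the exponential function. -/
theorem eexp_integral_le {Ω : Type*} [MeasurableSpace Ω] {μ : Measure Ω} [IsProbabilityMeasure μ]
    {f : Ω → ℝ} (hf : Integrable f μ) : eexp (∫ z, f z ∂μ) ≤ ∫⁻ z, eexp (f z) ∂μ := by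
  set c := ∫ z, f z ∂μ
  -- The tangent line of `exp` at the mean; only this affine minorant has to be integrable, not `exp
  -- ∘ f`.
  have h1 : Integrable (fun z => Real.exp c * (1 + (f z - c))) μ := by fun_prop
  have h2 : ∫ z, Real.exp c * (1 + (f z - c)) ∂μ = Real.exp c := by
    rw [integral_const_mul, integral_add (by fun_prop) (by fun_prop),
      integral_sub (by fun_prop) (by fun_prop)]
    simp [c]
  calc eexp c = ENNReal.ofReal (∫ z, Real.exp c * (1 + (f z - c)) ∂μ) := by rw [h2]; rfl
    _ ≤ ∫⁻ z, ENNReal.ofReal (Real.exp c * (1 + (f z - c))) ∂μ := by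
        rw [integral_eq_lintegral_pos_part_sub_lintegral_neg_part h1]
        refine (ENNReal.ofReal_le_ofReal (sub_le_self _ ENNReal.toReal_nonneg)).trans ?_
        exact ENNReal.ofReal_toReal_le
    _ ≤ _ := by
        refine lintegral_mono fun z => ENNReal.ofReal_le_ofReal ?_
        have : Real.exp (f z) = Real.exp c * Real.exp (f z - c) := by
          rw [← Real.exp_add]; ring_nf
        rw [this]
        gcongr
        linarith [Real.add_one_le_exp (f z - c)]

/-! ### Symmetrization -/

section Symmetrization

variable {ι : Type*} [Finite ι] [Nonempty ι] {Ω : Type*} [MeasurableSpace Ω] {μ : Measure Ω}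
  [IsProbabilityMeasure μ]

/-- Half of `a j` goes to each of `u` and `v`, then `e^{(x+y)/2} ≤ (e^x + e^y)/2`. This decouples
mean and sample without a ghost sample, at the price of the factor `2`. -/
theorem eexp_iSup_add_le (a u v : ι → ℝ) :
    eexp (⨆ j, (a j + (u j - v j))) ≤
      2⁻¹ * (eexp (⨆ j, (a j + 2 * u j)) + eexp (⨆ j, (a j - 2 * v j))) := by
  have h : ⨆ j, (a j + (u j - v j)) ≤
      (⨆ j, (a j + 2 * u j)) / 2 + (⨆ j, (a j - 2 * v j)) / 2 := by
    refine ciSup_le fun j => ?_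
    have h1 := le_ciSup (f := fun j => a j + 2 * u j) (Set.finite_range _).bddAbove j
    have h2 := le_ciSup (f := fun j => a j - 2 * v j) (Set.finite_range _).bddAbove j
    linarith
  refine (eexp_mono h).trans ?_
  set x := ⨆ j, (a j + 2 * u j)
  set y := ⨆ j, (a j - 2 * v j)
  have h2 : (2⁻¹ : ℝ≥0∞) = ENNReal.ofReal 2⁻¹ := by
    rw [ENNReal.ofReal_inv_of_pos two_pos]; simp
  rw [eexp, eexp, eexp, ← ENNReal.ofReal_add (by positivity) (by positivity), h2,
    ← ENNReal.ofReal_mul (by positivity)]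
  refine ENNReal.ofReal_le_ofReal ?_
  have hx : Real.exp x = Real.exp (x / 2) ^ 2 := by rw [← Real.exp_nat_mul]; ring_nf
  have hy : Real.exp y = Real.exp (y / 2) ^ 2 := by rw [← Real.exp_nat_mul]; ring_nf
  rw [Real.exp_add, hx, hy]
  nlinarith [sq_nonneg (Real.exp (x / 2) - Real.exp (y / 2))]

/-- Symmetrization of one summand of an empirical process. -/
theorem lintegral_eexp_iSup_sub_le {f : ι → Ω → ℝ} (hfm : ∀ j, Measurable (f j))
    (hf : ∀ j, Integrable (f j) μ) (a : ι → ℝ) :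
    ∫⁻ z, eexp (⨆ j, (a j + (∫ x, f j x ∂μ - f j z))) ∂μ ≤
      2⁻¹ * ∫⁻ z, (eexp (⨆ j, (a j + 2 * f j z)) + eexp (⨆ j, (a j - 2 * f j z))) ∂μ := by
  have := Fintype.ofFinite ι
  have h1 : eexp (⨆ j, (a j + 2 * ∫ x, f j x ∂μ)) ≤ ∫⁻ z, eexp (⨆ j, (a j + 2 * f j z)) ∂μ := by
    obtain ⟨j, hj⟩ := exists_eq_ciSup_of_finite (f := fun j => a j + 2 * ∫ x, f j x ∂μ)
    have hint : ∫ x, (a j + 2 * f j x) ∂μ = a j + 2 * ∫ x, f j x ∂μ := by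
      rw [integral_add (integrable_const _) ((hf j).const_mul 2), integral_const_mul]; simp
    rw [← hj, ← hint]
    refine (eexp_integral_le ((integrable_const _).add ((hf j).const_mul 2))).trans ?_
    exact lintegral_mono fun z => eexp_mono
      (le_ciSup (f := fun j => a j + 2 * f j z) (Set.finite_range _).bddAbove j)
  calc _ ≤ ∫⁻ z, 2⁻¹ * (eexp (⨆ j, (a j + 2 * ∫ x, f j x ∂μ)) +
          eexp (⨆ j, (a j - 2 * f j z))) ∂μ :=
        lintegral_mono fun z => eexp_iSup_add_le a (fun j => ∫ x, f j x ∂μ) fun j => f j z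
    _ = 2⁻¹ * (eexp (⨆ j, (a j + 2 * ∫ x, f j x ∂μ)) +
          ∫⁻ z, eexp (⨆ j, (a j - 2 * f j z)) ∂μ) := by
        rw [lintegral_const_mul _ (by fun_prop), lintegral_add_left measurable_const]
        simp
    _ ≤ _ := by
        rw [lintegral_add_left (by fun_prop)]
        gcongr

end Symmetrization

/-! ### Product measures and replacement of summands -/

section Product

variable {Ω : Type} [MeasurableSpace Ω] {μ : Measure Ω} [IsProbabilityMeasure μ]

theorem measurePreserving_finCons (m : ℕ) :
    MeasurePreserving (fun z : Ω × (Fin m → Ω) => (Fin.cons z.1 z.2 : Fin (m + 1) → Ω))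
      (μ.prod (Measure.pi fun _ => μ)) (Measure.pi fun _ => μ) := by
  have h := (measurePreserving_piFinSuccAbove (fun _ : Fin (m + 1) => μ) 0).symm
  convert! h using 1
  ext z : 1
  simp [MeasurableEquiv.piFinSuccAbove]
  rfl

theorem lintegral_pi_succ {m : ℕ} {f : (Fin (m + 1) → Ω) → ℝ≥0∞} (hf : Measurable f) :
    ∫⁻ z, f z ∂(Measure.pi fun _ => μ) =
      ∫⁻ x, ∫⁻ z, f (Fin.cons x z) ∂(Measure.pi fun _ => μ) ∂μ := by
  have h := measurePreserving_finCons (μ := μ) m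
  rw [← h.lintegral_comp hf]
  exact lintegral_prod (fun z : Ω × (Fin m → Ω) => f (Fin.cons z.1 z.2))
    (hf.comp h.measurable).aemeasurable

theorem lintegral_pi_prod {κ : Type*} [Fintype κ] {Ω : κ → Type*} [∀ i, MeasurableSpace (Ω i)]
    (μ : ∀ i, Measure (Ω i)) [∀ i, IsProbabilityMeasure (μ i)] {f : ∀ i, Ω i → ℝ≥0∞}
    (hf : ∀ i, Measurable (f i)) :
    ∫⁻ z, ∏ i, f i (z i) ∂(Measure.pi μ) = ∏ i, ∫⁻ x, f i x ∂(μ i) := by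
  have h := lintegral_prod_eq_prod_lintegral_of_indepFun Finset.univ (fun i (z : ∀ i, Ω i) => f i (z i))
    (iIndepFun_pi (μ := μ) fun i => (hf i).aemeasurable)
    (fun i => (hf i).comp (measurable_pi_apply i))
  rw [h]
  exact Finset.prod_congr rfl fun i _ => (measurePreserving_eval μ i).lintegral_comp (hf i)

variable {ι : Type*} [Finite ι] {Ω' : Type} [MeasurableSpace Ω'] {γ : Measure Ω'}
  [IsProbabilityMeasure γ]

/-- Comparison of the exponential moments of two empirical processes, from a comparison that holds
for one summand. -/
theorem lintegral_eexp_iSup_sum_le {g : ι → Ω → ℝ} {h : ι → Ω' → ℝ} (hg : ∀ j, Measurable (g j))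
    (hh : ∀ j, Measurable (h j))
    (H : ∀ a : ι → ℝ, ∫⁻ z, eexp (⨆ j, (a j + g j z)) ∂μ ≤ ∫⁻ x, eexp (⨆ j, (a j + h j x)) ∂γ)
    (m : ℕ) (a : ι → ℝ) :
    ∫⁻ z, eexp (⨆ j, (a j + ∑ i, g j (z i))) ∂(Measure.pi fun _ : Fin m => μ) ≤
      ∫⁻ x, eexp (⨆ j, (a j + ∑ i, h j (x i))) ∂(Measure.pi fun _ : Fin m => γ) := by
  -- The free offset `a` absorbs the summands that are frozen while the others are replaced.
  induction m generalizing a with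
  | zero => simp
  | succ m ih =>
    rw [lintegral_pi_succ (by fun_prop), lintegral_pi_succ (by fun_prop)]
    simp only [Fin.sum_univ_succ, Fin.cons_zero, Fin.cons_succ]
    calc _ ≤ ∫⁻ z, ∫⁻ x, eexp (⨆ j, (a j + g j z + ∑ i, h j (x i)))
          ∂(Measure.pi fun _ : Fin m => γ) ∂μ := by
          refine lintegral_mono fun z => ?_
          simp_rw [← add_assoc]
          exact ih fun j => a j + g j z
      _ = ∫⁻ x, ∫⁻ z, eexp (⨆ j, ((a j + ∑ i, h j (x i)) + g j z)) ∂μ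
          ∂(Measure.pi fun _ : Fin m => γ) := by
          rw [lintegral_lintegral_swap]
          · simp_rw [add_right_comm]
          · refine Measurable.aemeasurable ?_
            simp only [Function.uncurry_def]
            fun_prop
      _ ≤ ∫⁻ x, ∫⁻ y, eexp (⨆ j, ((a j + ∑ i, h j (x i)) + h j y)) ∂γ
          ∂(Measure.pi fun _ : Fin m => γ) := lintegral_mono fun x => H _
      _ = _ := by
          rw [lintegral_lintegral_swap]
          · simp_rw [add_assoc, add_comm (∑ i, _)]
          · refine Measurable.aemeasurable ?_
            simp only [Function.uncurry_def]
            fun_prop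

end Product

/-! ### Gaussian tensors -/

section Gaussian

variable {K : ℕ} {n : Fin K → ℕ}

instance : IsProbabilityMeasure (stdGaussianTensor n) := by
  unfold stdGaussianTensor; infer_instance

@[fun_prop]
theorem measurable_tensorInner (W : Tensor n) : Measurable (tensorInner W) := by
  unfold tensorInner; fun_prop

theorem lintegral_stdGaussianTensor_neg {f : Tensor n → ℝ≥0∞} (hf : Measurable f) :
    ∫⁻ x, f (-x) ∂stdGaussianTensor n = ∫⁻ x, f x ∂stdGaussianTensor n := by
  have h : MeasurePreserving (fun x : Tensor n => -x) (stdGaussianTensor n)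
      (stdGaussianTensor n) := by
    refine ⟨measurable_neg, ?_⟩
    have := Measure.pi_map_pi (μ := fun _ : ((k : Fin K) → Fin (n k)) => gaussianReal 0 1)
      (f := fun _ x => -x) fun _ => measurable_neg.aemeasurable
    simp only [gaussianReal_map_neg, neg_zero] at this
    exact this
  exact h.lintegral_comp hf

theorem lintegral_eexp_gaussianReal (c : ℝ) :
    ∫⁻ x, eexp (c * x) ∂(gaussianReal 0 1) = eexp (c ^ 2 / 2) := by
  have h := congrFun (mgf_id_gaussianReal (μ := 0) (v := 1)) c
  simp only [mgf, id, zero_mul, zero_add, NNReal.coe_one, one_mul] at h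
  unfold eexp
  rw [← ofReal_integral_eq_lintegral_ofReal _ (ae_of_all _ fun x => (Real.exp_pos _).le), h]
  exact integrable_exp_mul_gaussianReal c

theorem lintegral_eexp_tensorInner (W : Tensor n) (c : ℝ) :
    ∫⁻ x, eexp (c * tensorInner W x) ∂stdGaussianTensor n =
      eexp (c ^ 2 * tensorInner W W / 2) := by
  simp only [tensorInner, Finset.mul_sum, Finset.sum_div, eexp_sum]
  unfold stdGaussianTensor
  rw [lintegral_pi_prod (f := fun i x => eexp (c * (W i * x))) _ fun i => by fun_prop]
  refine Finset.prod_congr rfl fun i _ => ?_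
  simp_rw [← mul_assoc, lintegral_eexp_gaussianReal]
  ring_nf

end Gaussian

/-! ### Tail and mean from exponential moments -/

section Chernoff

variable {Ω : Type*} [MeasurableSpace Ω] {μ : Measure Ω}

theorem measure_ge_le_eexp {X : Ω → ℝ} (hX : Measurable X) {A s : ℝ}
    (h : ∀ c : ℝ, 0 ≤ c → ∫⁻ z, eexp (c * X z) ∂μ ≤ eexp (A + c ^ 2 * s ^ 2 / 2))
    {c : ℝ} (hc : 0 ≤ c) (t : ℝ) :
    μ {z | t ≤ X z} ≤ eexp (A + c ^ 2 * s ^ 2 / 2 - c * t) := by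
  have h1 : eexp (c * t) * μ {z | t ≤ X z} ≤ eexp (A + c ^ 2 * s ^ 2 / 2) := by
    refine le_trans ?_ (h c hc)
    refine le_trans ?_ (mul_meas_ge_le_lintegral (by fun_prop) (eexp (c * t)))
    gcongr
    exact fun hz => eexp_mono (mul_le_mul_of_nonneg_left hz hc)
  have h2 : A + c ^ 2 * s ^ 2 / 2 = c * t + (A + c ^ 2 * s ^ 2 / 2 - c * t) := by ring
  rw [h2, eexp_add] at h1
  exact (ENNReal.mul_le_mul_iff_right (eexp_pos _).ne' (eexp_ne_top _)).1 h1

/-- The Chernoff bound for a variable with a sub-Gaussian exponential moment bound. -/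
theorem measure_gt_le_eexp {X : Ω → ℝ} (hX : Measurable X) {A s : ℝ} (hA : 0 ≤ A) (hs : 0 ≤ s)
    (h : ∀ c : ℝ, 0 ≤ c → ∫⁻ z, eexp (c * X z) ∂μ ≤ eexp (A + c ^ 2 * s ^ 2 / 2))
    {D : ℝ} (hD : 0 ≤ D) : μ {z | s * √(2 * (A + D)) < X z} ≤ eexp (-D) := by
  set t := s * √(2 * (A + D)) with ht
  have ht0 : 0 ≤ t := by positivity
  have key : ∀ t' : ℝ, t < t' → μ {z | t' ≤ X z} ≤ eexp (-D) := by
    -- If `s = 0`, the threshold is `0` and only a strictly larger `t'` admits a useful `c`, namely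
    -- `(A + D) / t'`; otherwise `c = t / s²` is optimal.
    intro t' htt'
    rcases hs.eq_or_lt with rfl | hs
    · have hpos : 0 < t' := ht0.trans_lt htt'
      refine (measure_ge_le_eexp hX h (c := (A + D) / t') (by positivity) t').trans
        (eexp_mono ?_)
      field_simp
      linarith
    · have hsub : {z | t' ≤ X z} ⊆ {z | t ≤ X z} := fun z hz => htt'.le.trans hz
      refine (measure_mono hsub).trans <|
        (measure_ge_le_eexp hX h (c := t / s ^ 2) (by positivity) t).trans (eexp_mono ?_)
      have ht2 : t ^ 2 = s ^ 2 * (2 * (A + D)) := by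
        rw [ht, mul_pow, Real.sq_sqrt (by positivity)]
      have : (t / s ^ 2) ^ 2 * s ^ 2 / 2 - t / s ^ 2 * t = -(t ^ 2) / s ^ 2 / 2 := by
        field_simp; ring
      have h3 : -(t ^ 2) / s ^ 2 / 2 = -(A + D) := by rw [ht2]; field_simp
      linarith
  have hU : {z | t < X z} = ⋃ k : ℕ, {z | t + 1 / ((k : ℝ) + 1) ≤ X z} := by
    ext z
    simp only [Set.mem_ofPred_eq, Set.mem_iUnion]
    constructor
    · intro hz
      obtain ⟨k, hk⟩ := exists_nat_one_div_lt (sub_pos.2 hz)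
      exact ⟨k, by linarith⟩
    · rintro ⟨k, hk⟩
      have : (0 : ℝ) < 1 / ((k : ℝ) + 1) := by positivity
      linarith
  have hmono : Monotone fun k : ℕ => {z | t + 1 / ((k : ℝ) + 1) ≤ X z} := by
    intro k k' hkk z hz
    refine le_trans ?_ (show t + 1 / ((k : ℝ) + 1) ≤ X z from hz)
    gcongr
  rw [hU, hmono.measure_iUnion]
  refine iSup_le fun k => key _ ?_
  have : (0 : ℝ) < 1 / ((k : ℝ) + 1) := by positivity
  linarith

/-- Jensen gives `c e ≤ A + c² s² / 2` for the mean `e` and all `c ≥ 0`; take `c = e / s²`. -/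
theorem integral_le_of_lintegral_eexp_le [IsProbabilityMeasure μ] {X : Ω → ℝ}
    (hX : Integrable X μ) {A s : ℝ} (hA : 0 ≤ A) (hs : 0 ≤ s)
    (h : ∀ c : ℝ, 0 ≤ c → ∫⁻ z, eexp (c * X z) ∂μ ≤ eexp (A + c ^ 2 * s ^ 2 / 2)) :
    ∫ z, X z ∂μ ≤ s * √(2 * A) := by
  set e := ∫ z, X z ∂μ with he
  have h1 : ∀ c : ℝ, 0 ≤ c → c * e ≤ A + c ^ 2 * s ^ 2 / 2 := by
    intro c hc
    have h2 := (eexp_integral_le (hX.const_mul c)).trans (h c hc)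
    rw [integral_const_mul] at h2
    exact Real.exp_le_exp.1 ((ENNReal.ofReal_le_ofReal_iff (Real.exp_pos _).le).1 h2)
  rcases le_or_gt e 0 with h0 | h0
  · exact h0.trans (by positivity)
  rcases hs.eq_or_lt with rfl | hs
  · have := h1 ((A + 1) / e) (by positivity)
    rw [div_mul_cancel₀ _ h0.ne'] at this
    linarith
  · have h2 := h1 (e / s ^ 2) (by positivity)
    have h3 : (e / s) ^ 2 ≤ 2 * A := by
      have e1 : e / s ^ 2 * e = (e / s) ^ 2 := by field_simp
      have e2 : (e / s ^ 2) ^ 2 * s ^ 2 / 2 = (e / s) ^ 2 / 2 := by field_simp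
      linarith
    have h4 := Real.le_sqrt_of_sq_le h3
    rwa [div_le_iff₀ hs, mul_comm] at h4

end Chernoff

/-! ### Hoeffding's lemma and McDiarmid's inequality -/

section BoundedDifferences

variable {Ω : Type} [MeasurableSpace Ω] {μ : Measure Ω} [IsProbabilityMeasure μ]

theorem lintegral_eexp_le_of_osc {g : Ω → ℝ} (hg : Measurable g) {c : ℝ}
    (h : ∀ x y, g x ≤ g y + c) (b : ℝ) :
    ∫⁻ x, eexp (b * (g x - ∫ y, g y ∂μ)) ∂μ ≤ eexp (b ^ 2 * c ^ 2 / 8) := by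
  have : Nonempty Ω := nonempty_of_isProbabilityMeasure μ
  have hbdd : BddBelow (Set.range g) :=
    ⟨g (Classical.arbitrary Ω) - c, by rintro _ ⟨y, rfl⟩; linarith [h (Classical.arbitrary Ω) y]⟩
  have hmem : ∀ x, g x ∈ Set.Icc (⨅ y, g y) ((⨅ y, g y) + c) := fun x =>
    ⟨ciInf_le hbdd x, by
      have : g x - c ≤ ⨅ y, g y := le_ciInf fun y => by linarith [h x y]
      linarith⟩
  have hsub := hasSubgaussianMGF_of_mem_Icc (μ := μ) hg.aemeasurable (ae_of_all _ hmem)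
  have h1 := hsub.mgf_le b
  have h2 := hsub.integrable_exp_mul b
  unfold eexp
  rw [← ofReal_integral_eq_lintegral_ofReal h2 (ae_of_all _ fun x => (Real.exp_pos _).le)]
  refine ENNReal.ofReal_le_ofReal (h1.trans (Real.exp_le_exp.2 (le_of_eq ?_)))
  rw [add_sub_cancel_left]
  push_cast
  rw [div_pow, Real.norm_eq_abs, sq_abs]
  ring

/-- **McDiarmid's inequality**, for the exponential moments. -/
theorem lintegral_eexp_le_of_bounded_differences {m : ℕ} {f : (Fin m → Ω) → ℝ}
    (hf : Measurable f) {C : ℝ} (hC : ∀ z, |f z| ≤ C) {c : ℝ}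
    (h : ∀ z i x, f (Function.update z i x) ≤ f z + c) (b : ℝ) :
    ∫⁻ z, eexp (b * (f z - ∫ w, f w ∂(Measure.pi fun _ => μ))) ∂(Measure.pi fun _ => μ) ≤
      eexp (b ^ 2 * (m * c ^ 2) / 8) := by
  induction m with
  | zero =>
    have hz : ∀ z, f z = f default := fun z => by rw [Subsingleton.elim z default]
    simp [hz]
  | succ m ih =>
    have hcons := measurePreserving_finCons (μ := μ) m
    have hF : Measurable fun p : Ω × (Fin m → Ω) => f (Fin.cons p.1 p.2) :=
      hf.comp hcons.measurable
    have hFx : ∀ x, Measurable fun z : Fin m → Ω => f (Fin.cons x z) := fun x =>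
      hF.comp measurable_prodMk_left
    have hint : Integrable (fun p : Ω × (Fin m → Ω) => f (Fin.cons p.1 p.2))
        (μ.prod (Measure.pi fun _ => μ)) :=
      Integrable.of_bound hF.aestronglyMeasurable C (ae_of_all _ fun p => hC _)
    have hintx : ∀ x, Integrable (fun z : Fin m → Ω => f (Fin.cons x z))
        (Measure.pi fun _ => μ) := fun x =>
      Integrable.of_bound (hFx x).aestronglyMeasurable C (ae_of_all _ fun p => hC _)
    -- Conditional expectation given the first coordinate: `g` inherits the oscillation bound `c`,
    -- and `f - g` is handled by induction with that coordinate frozen.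
    set g : Ω → ℝ := fun x => ∫ z, f (Fin.cons x z) ∂(Measure.pi fun _ : Fin m => μ) with hg
    have hgm : Measurable g := hF.stronglyMeasurable.integral_prod_right'.measurable
    have hgint : ∫ w, f w ∂(Measure.pi fun _ => μ) = ∫ x, g x ∂μ := by
      rw [← hcons.map_eq, integral_map hcons.measurable.aemeasurable hf.aestronglyMeasurable,
        integral_prod _ hint]
    have hosc : ∀ x y, g x ≤ g y + c := by
      intro x y
      have : g y + c = ∫ z, (f (Fin.cons y z) + c) ∂(Measure.pi fun _ : Fin m => μ) := by
        rw [integral_add (hintx y) (integrable_const _)]; simp [hg]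
      rw [this]
      refine integral_mono (hintx x) ((hintx y).add (integrable_const _)) fun z => ?_
      have := h (Fin.cons y z) 0 x
      rwa [Fin.update_cons_zero] at this
    rw [hgint, lintegral_pi_succ (by fun_prop)]
    calc _ = ∫⁻ x, eexp (b * (g x - ∫ y, g y ∂μ)) *
          ∫⁻ z, eexp (b * (f (Fin.cons x z) - g x)) ∂(Measure.pi fun _ => μ) ∂μ := by
          refine lintegral_congr fun x => ?_
          have hmeas : Measurable fun z : Fin m → Ω => eexp (b * (f (Fin.cons x z) - g x)) :=
            measurable_eexp.comp (((hFx x).sub_const _).const_mul b)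
          rw [← lintegral_const_mul _ hmeas]
          refine lintegral_congr fun z => ?_
          rw [← eexp_add]
          ring_nf
      _ ≤ ∫⁻ x, eexp (b * (g x - ∫ y, g y ∂μ)) * eexp (b ^ 2 * (m * c ^ 2) / 8) ∂μ := by
          refine lintegral_mono fun x => ?_
          gcongr
          refine ih (hFx x) (fun z => hC _) fun z i y => ?_
          rw [Fin.cons_update]
          exact h _ _ _
      _ = (∫⁻ x, eexp (b * (g x - ∫ y, g y ∂μ)) ∂μ) * eexp (b ^ 2 * (m * c ^ 2) / 8) := by
          rw [lintegral_mul_const _ (by fun_prop)]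
      _ ≤ eexp (b ^ 2 * c ^ 2 / 8) * eexp (b ^ 2 * (m * c ^ 2) / 8) := by
          gcongr
          exact lintegral_eexp_le_of_osc hgm hosc b
      _ = _ := by
          rw [← eexp_add]
          push_cast
          ring_nf

end BoundedDifferences

/-! ### The deviation process and its Gaussian comparison -/

section Deviation

variable {K : ℕ} {n : Fin K → ℕ} {Y : Set ℝ} {l : ℝ → Y → ℝ} {Λ : ℝ≥0}
  {μ : Measure (Tensor n × Y)} {W₀ : Tensor n}

theorem tensorInner_sub_left (V W X : Tensor n) :
    tensorInner (V - W) X = tensorInner V X - tensorInner W X := by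
  simp [tensorInner, sub_mul]

theorem tensorInner_sum_right {m : ℕ} (W : Tensor n) (x : Fin m → Tensor n) :
    tensorInner W (∑ i, x i) = ∑ i, tensorInner W (x i) := by
  simp only [tensorInner, Finset.sum_apply, Finset.mul_sum]
  exact Finset.sum_comm

theorem tensorInner_neg_right (W X : Tensor n) : tensorInner W (-X) = -tensorInner W X := by
  simp [tensorInner]

/-- The loss of `W` in excess of the loss of `W₀`. -/
def excessLoss (l : ℝ → Y → ℝ) (W₀ W : Tensor n) (z : Tensor n × Y) : ℝ :=
  l (tensorInner W z.1) z.2 - l (tensorInner W₀ z.1) z.2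

/-- The deviation of the empirical excess risk of `W` from its expectation. -/
noncomputable def deviation {m : ℕ} (l : ℝ → Y → ℝ) (μ : Measure (Tensor n × Y))
    (W₀ W : Tensor n) (z : Fin m → Tensor n × Y) : ℝ :=
  risk l μ W - risk l μ W₀ - (empRisk l z W - empRisk l z W₀)

theorem measurable_loss (hl : Measurable (Function.uncurry l)) (W : Tensor n) :
    Measurable fun z : Tensor n × Y => l (tensorInner W z.1) z.2 :=
  hl.comp (((measurable_tensorInner W).comp measurable_fst).prodMk measurable_snd)

theorem measurable_excessLoss (hl : Measurable (Function.uncurry l)) (W₀ W : Tensor n) :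
    Measurable (excessLoss l W₀ W) :=
  (measurable_loss hl W).sub (measurable_loss hl W₀)

theorem measurable_deviation (hl : Measurable (Function.uncurry l)) {m : ℕ} (W₀ W : Tensor n) :
    Measurable (deviation (m := m) l μ W₀ W) := by
  have h := fun V => measurable_loss hl (n := n) V
  unfold deviation empRisk
  have h1 : ∀ V, Measurable fun z : Fin m → Tensor n × Y =>
      ∑ i, l (tensorInner V (z i).1) (z i).2 := fun V =>
    Finset.measurable_sum _ fun i _ => (h V).comp (measurable_pi_apply i)
  exact measurable_const.sub (((h1 W).const_mul _).sub ((h1 W₀).const_mul _))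

section Integrable

variable (hint : ∀ W : Tensor n, Integrable (fun z => l (tensorInner W z.1) z.2) μ)
include hint

theorem integral_excessLoss (W₀ W : Tensor n) :
    ∫ z, excessLoss l W₀ W z ∂μ = risk l μ W - risk l μ W₀ :=
  integral_sub (hint W) (hint W₀)

theorem deviation_eq_sum {m : ℕ} (hm : 0 < m) (W₀ W : Tensor n) (z : Fin m → Tensor n × Y) :
    deviation l μ W₀ W z =
      ∑ i, 1 / (m : ℝ) * (∫ x, excessLoss l W₀ W x ∂μ - excessLoss l W₀ W (z i)) := by
  have hm' : (m : ℝ) ≠ 0 := by exact_mod_cast hm.ne'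
  rw [integral_excessLoss hint, ← Finset.mul_sum, Finset.sum_sub_distrib]
  simp only [deviation, empRisk, excessLoss, Finset.sum_sub_distrib, Finset.sum_const,
    Finset.card_univ, Fintype.card_fin, nsmul_eq_mul]
  field_simp

end Integrable

variable (hl : Measurable (Function.uncurry l)) (hΛ : ∀ y : Y, LipschitzWith Λ fun a => l a y)
  (hint : ∀ W : Tensor n, Integrable (fun z => l (tensorInner W z.1) z.2) μ)
  (hμ : μ.map Prod.fst = stdGaussianTensor n)

theorem lintegral_comp_fst (hμ : μ.map Prod.fst = stdGaussianTensor n) {f : Tensor n → ℝ≥0∞}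
    (hf : Measurable f) : ∫⁻ z, f z.1 ∂μ = ∫⁻ x, f x ∂stdGaussianTensor n := by
  rw [← hμ, lintegral_map hf measurable_fst]

include hl hΛ hint hμ in
/-- Gaussian comparison for one summand of the empirical excess risk process. -/
theorem lintegral_eexp_iSup_excessLoss_le [IsProbabilityMeasure μ] {ι : Type*} [Finite ι]
    [Nonempty ι] (W : ι → Tensor n) (c : ℝ) (a : ι → ℝ) :
    ∫⁻ z, eexp (⨆ j, (a j + c * (∫ x, excessLoss l W₀ (W j) x ∂μ - excessLoss l W₀ (W j) z))) ∂μ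
      ≤ ∫⁻ x, eexp (⨆ j, (a j + 2 * c * Λ * tensorInner (W j - W₀) x)) ∂stdGaussianTensor n := by
  have hfi : ∀ j, Integrable (excessLoss l W₀ (W j)) μ := fun j => (hint (W j)).sub (hint W₀)
  have hfm : ∀ j, Measurable (excessLoss l W₀ (W j)) := fun j => measurable_excessLoss hl _ _
  have h1 := lintegral_eexp_iSup_sub_le (μ := μ) (f := fun j z => c * excessLoss l W₀ (W j) z)
    (fun j => (hfm j).const_mul c) (fun j => (hfi j).const_mul c) a
  simp only [integral_const_mul, ← mul_sub] at h1
  refine h1.trans ?_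
  set τ : ι → Tensor n → ℝ := fun j x => 2 * c * Λ * tensorInner (W j - W₀) x with hτ
  have hτm : ∀ j, Measurable (τ j) := fun j => by simp only [hτ]; fun_prop
  have h2 : ∀ z : Tensor n × Y, eexp (⨆ j, (a j + 2 * (c * excessLoss l W₀ (W j) z))) +
      eexp (⨆ j, (a j - 2 * (c * excessLoss l W₀ (W j) z))) ≤
      eexp (⨆ j, (a j + τ j z.1)) + eexp (⨆ j, (a j - τ j z.1)) := by
    intro z
    unfold eexp
    rw [← ENNReal.ofReal_add (Real.exp_pos _).le (Real.exp_pos _).le,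
      ← ENNReal.ofReal_add (Real.exp_pos _).le (Real.exp_pos _).le]
    have hL : ∀ V V' : Tensor n, |2 * (c * (l (tensorInner V z.1) z.2 - l (tensorInner V' z.1) z.2))|
        ≤ |2 * c * Λ * (tensorInner V z.1 - tensorInner V' z.1)| := by
      intro V V'
      have := (hΛ z.2).dist_le_mul (tensorInner V z.1) (tensorInner V' z.1)
      rw [Real.dist_eq, Real.dist_eq] at this
      rw [← mul_assoc, mul_assoc (2 * c), abs_mul, abs_mul (2 * c), abs_mul (Λ : ℝ),
        abs_of_nonneg Λ.coe_nonneg]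
      gcongr
    refine ENNReal.ofReal_le_ofReal (exp_iSup_add_exp_iSup_le (fun j => ?_) fun j k => ?_)
    · simp only [hτ, tensorInner_sub_left]
      exact hL _ _
    · simp only [hτ, tensorInner_sub_left, excessLoss]
      have := hL (W j) (W k)
      convert this using 2 <;> ring
  calc _ ≤ 2⁻¹ * ∫⁻ z, (eexp (⨆ j, (a j + τ j z.1)) + eexp (⨆ j, (a j - τ j z.1))) ∂μ := by
        exact mul_le_mul' le_rfl (lintegral_mono h2)
    _ = 2⁻¹ * (∫⁻ x, eexp (⨆ j, (a j + τ j x)) ∂stdGaussianTensor n +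
          ∫⁻ x, eexp (⨆ j, (a j + τ j (-x))) ∂stdGaussianTensor n) := by
        rw [lintegral_add_left (by fun_prop),
          lintegral_comp_fst hμ (f := fun x => eexp (⨆ j, (a j + τ j x))) (by fun_prop),
          lintegral_comp_fst hμ (f := fun x => eexp (⨆ j, (a j - τ j x))) (by fun_prop)]
        simp only [hτ, tensorInner_neg_right, mul_neg, sub_eq_add_neg]
    _ = _ := by
        -- The two signs contribute equally, which cancels the factor `2⁻¹`.
        rw [lintegral_stdGaussianTensor_neg (f := fun x => eexp (⨆ j, (a j + τ j x)))
          (by fun_prop), ← two_mul, ← mul_assoc,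
          ENNReal.inv_mul_cancel two_ne_zero ENNReal.ofNat_ne_top, one_mul]

/-- Exponential moments of the supremum of a Gaussian process over a soverlap ball. -/
theorem lintegral_eexp_iSup_tensorInner_le (hK : 0 < K) (hn : ∀ k, 0 < n k) {ι : Type*} [Finite ι]
    [Nonempty ι] {W : ι → Tensor n} {B₀ : ℝ} (hW : ∀ j, soverlapNorm (W j) ≤ B₀)
    (hW₀ : soverlapNorm W₀ ≤ B₀) {b : ℝ} (hb : 0 ≤ b) (m : ℕ) :
    ∫⁻ x, eexp (⨆ j, ∑ i, b * tensorInner (W j - W₀) (x i))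
        ∂(Measure.pi fun _ : Fin m => stdGaussianTensor n) ≤
      eexp (5 * (weightSum n * dimFactor n) ^ 2 + m * (8 * b * (B₀ / weightSum n)) ^ 2 / 2) := by
  obtain ⟨𝒯, hcard, hT, hG⟩ := exists_finset_tensorInner_le hK hn
  -- The `8` is `4` from the two nets times `2` for bounding `W` and `W₀` separately.
  set β := 8 * b * (B₀ / weightSum n) with hβ
  have h1 : ∀ x : Fin m → Tensor n, eexp (⨆ j, ∑ i, b * tensorInner (W j - W₀) (x i)) ≤
      ∑ T ∈ 𝒯, ∏ i, eexp (β * tensorInner T (x i)) := by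
    intro x
    obtain ⟨T, hTm, hTW⟩ := hG (∑ i, x i)
    have h2 : ⨆ j, ∑ i, b * tensorInner (W j - W₀) (x i) ≤ ∑ i, β * tensorInner T (x i) := by
      refine ciSup_le fun j => ?_
      rw [← Finset.mul_sum, ← Finset.mul_sum, ← tensorInner_sum_right, ← tensorInner_sum_right,
        tensorInner_sub_left]
      have e1 := (abs_le.1 (hTW (W j) B₀ (hW j))).2
      have e2 := (abs_le.1 (hTW W₀ B₀ hW₀)).1
      calc _ ≤ b * (2 * (B₀ / weightSum n * (4 * tensorInner T (∑ i, x i)))) := by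
            gcongr; linarith
        _ = _ := by rw [hβ]; ring
    refine (eexp_mono h2).trans ?_
    rw [eexp_sum]
    exact Finset.single_le_sum (f := fun T => ∏ i, eexp (β * tensorInner T (x i)))
      (fun _ _ => zero_le) hTm
  calc _ ≤ ∫⁻ x, ∑ T ∈ 𝒯, ∏ i, eexp (β * tensorInner T (x i))
          ∂(Measure.pi fun _ : Fin m => stdGaussianTensor n) := lintegral_mono h1
    _ = ∑ T ∈ 𝒯, ∏ _i : Fin m, eexp (β ^ 2 * tensorInner T T / 2) := by
        rw [lintegral_finsetSum _ fun T _ => by fun_prop]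
        refine Finset.sum_congr rfl fun T _ => ?_
        rw [lintegral_pi_prod (f := fun _ x => eexp (β * tensorInner T x)) _ fun i => by fun_prop]
        simp_rw [lintegral_eexp_tensorInner]
    _ ≤ ∑ T ∈ 𝒯, eexp (m * β ^ 2 / 2) := by
        refine Finset.sum_le_sum fun T hTm => ?_
        rw [← eexp_sum]
        refine eexp_mono ?_
        rw [Finset.sum_const, Finset.card_univ, Fintype.card_fin, nsmul_eq_mul]
        have h3 := mul_le_mul_of_nonneg_left (mul_le_of_le_one_right (sq_nonneg β) (hT T hTm))
          (Nat.cast_nonneg m : (0 : ℝ) ≤ m)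
        linarith
    _ = 𝒯.card * eexp (m * β ^ 2 / 2) := by rw [Finset.sum_const, nsmul_eq_mul]
    _ ≤ eexp (5 * (weightSum n * dimFactor n) ^ 2) * eexp (m * β ^ 2 / 2) := by
        refine mul_le_mul' ?_ le_rfl
        rw [eexp, ← ENNReal.ofReal_natCast]
        exact ENNReal.ofReal_le_ofReal hcard
    _ = _ := by rw [← eexp_add]

include hl hΛ hint hμ in
-- The `16` is the symmetrization factor `2` times the `8` of the Gaussian bound, which is used with
-- `b = 2 c Λ / m`.
theorem lintegral_eexp_iSup_deviation_le [IsProbabilityMeasure μ] (hK : 0 < K)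
    (hn : ∀ k, 0 < n k) {m : ℕ} (hm : 0 < m) {ι : Type*} [Finite ι] [Nonempty ι]
    {W : ι → Tensor n} {B₀ : ℝ} (hW : ∀ j, soverlapNorm (W j) ≤ B₀)
    (hW₀ : soverlapNorm W₀ ≤ B₀) (c : ℝ) (hc : 0 ≤ c) :
    ∫⁻ z, eexp (c * ⨆ j, deviation l μ W₀ (W j) z) ∂(Measure.pi fun _ : Fin m => μ) ≤
      eexp (5 * (weightSum n * dimFactor n) ^ 2 +
        c ^ 2 * (16 * Λ * (B₀ / weightSum n) / √(m : ℝ)) ^ 2 / 2) := by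
  have hm' : (0 : ℝ) < m := by exact_mod_cast hm
  have hfm : ∀ j, Measurable (excessLoss l W₀ (W j)) := fun j => measurable_excessLoss hl _ _
  have h1 := lintegral_eexp_iSup_sum_le (μ := μ) (γ := stdGaussianTensor n)
    (g := fun j z => c * (1 / (m : ℝ)) *
      (∫ x, excessLoss l W₀ (W j) x ∂μ - excessLoss l W₀ (W j) z))
    (h := fun j x => 2 * (c * (1 / (m : ℝ))) * Λ * tensorInner (W j - W₀) x)
    (fun j => by fun_prop) (fun j => by fun_prop)
    (lintegral_eexp_iSup_excessLoss_le hl hΛ hint hμ W _) m 0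
  have h2 := lintegral_eexp_iSup_tensorInner_le hK hn hW hW₀
    (b := 2 * (c * (1 / (m : ℝ))) * Λ) (by positivity) m
  simp only [Pi.zero_apply, zero_add] at h1
  refine le_trans (le_of_eq ?_) (h1.trans (h2.trans_eq ?_))
  · refine lintegral_congr fun z => ?_
    rw [Real.mul_iSup_of_nonneg hc]
    simp only [deviation_eq_sum hint hm, Finset.mul_sum, mul_assoc]
  · congr 2
    rw [div_pow, Real.sq_sqrt hm'.le]
    field_simp
    ring

theorem measurable_iSup_deviation (hl : Measurable (Function.uncurry l)) {m : ℕ} {ι : Type*}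
    [Finite ι] (W : ι → Tensor n) :
    Measurable fun z : Fin m → Tensor n × Y => ⨆ j, deviation l μ W₀ (W j) z :=
  Measurable.iSup fun j => measurable_deviation hl W₀ (W j)

end Deviation

/-! ### From deviation bounds to excess risk -/

section RiskBounds

variable {K : ℕ} {n : Fin K → ℕ} {Y : Set ℝ} {l : ℝ → Y → ℝ} {Λ : ℝ≥0}
  {μ : Measure (Tensor n × Y)} {W₀ : Tensor n}

section Continuity

theorem integrable_abs_coord (hμ : μ.map Prod.fst = stdGaussianTensor n)
    (i : (k : Fin K) → Fin (n k)) : Integrable (fun z : Tensor n × Y => |z.1 i|) μ := by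
  have h1 : Integrable (fun x : Tensor n => x i) (stdGaussianTensor n) := by
    have h := (measurePreserving_eval (fun _ : (k : Fin K) → Fin (n k) => gaussianReal 0 1) i)
    have hid : Integrable (id : ℝ → ℝ) (gaussianReal 0 1) :=
      (memLp_id_gaussianReal 1).integrable (by simp)
    exact h.integrable_comp_of_integrable hid
  rw [← hμ] at h1
  exact (h1.comp_measurable measurable_fst).abs

theorem abs_tensorInner_le (W X : Tensor n) : |tensorInner W X| ≤ ‖W‖ * ∑ i, |X i| := by
  rw [tensorInner, Finset.mul_sum]
  refine (Finset.abs_sum_le_sum_abs _ _).trans (Finset.sum_le_sum fun i _ => ?_)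
  rw [abs_mul]
  gcongr
  exact norm_le_pi_norm W i

theorem continuous_risk (hΛ : ∀ y : Y, LipschitzWith Λ fun a => l a y)
    (hint : ∀ W : Tensor n, Integrable (fun z => l (tensorInner W z.1) z.2) μ)
    (hμ : μ.map Prod.fst = stdGaussianTensor n) : Continuous (risk l μ) := by
  have hI : Integrable (fun z : Tensor n × Y => ∑ i, |z.1 i|) μ :=
    integrable_finsetSum _ fun i _ => integrable_abs_coord hμ i
  refine LipschitzWith.continuous
    (K := (Λ * ∫ z : Tensor n × Y, ∑ i, |z.1 i| ∂μ).toNNReal)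
    (LipschitzWith.of_dist_le_mul fun V W => ?_)
  have h0 : 0 ≤ ∫ z : Tensor n × Y, ∑ i, |z.1 i| ∂μ := integral_nonneg fun z => by positivity
  rw [Real.coe_toNNReal _ (by positivity), dist_eq_norm, dist_eq_norm, risk, risk,
    ← integral_sub (hint V) (hint W)]
  calc _ ≤ ∫ z : Tensor n × Y, Λ * ‖V - W‖ * ∑ i, |z.1 i| ∂μ := by
        refine norm_integral_le_of_norm_le (hI.const_mul _) (ae_of_all _ fun z => ?_)
        have h1 := (hΛ z.2).dist_le_mul (tensorInner V z.1) (tensorInner W z.1)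
        rw [dist_eq_norm, Real.dist_eq, ← tensorInner_sub_left] at h1
        refine h1.trans ?_
        rw [mul_assoc]
        gcongr
        exact abs_tensorInner_le _ _
    _ = _ := by rw [integral_const_mul]; ring

theorem continuous_empRisk (hΛ : ∀ y : Y, LipschitzWith Λ fun a => l a y) {m : ℕ}
    (z : Fin m → Tensor n × Y) : Continuous (empRisk l z) := by
  unfold empRisk
  refine continuous_const.mul (continuous_finsetSum _ fun i _ => (hΛ _).continuous.comp ?_)
  unfold tensorInner
  fun_prop

end Continuity

/-- Excess risk bounds follow from uniform deviation bounds over the finite subfamilies of the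
constraint set. -/
theorem excessRiskBound_of_measure_le [IsProbabilityMeasure μ]
    (hl : Measurable (Function.uncurry l)) (hΛ : ∀ y : Y, LipschitzWith Λ fun a => l a y)
    (hint : ∀ W : Tensor n, Integrable (fun z => l (tensorInner W z.1) z.2) μ)
    (hμ : μ.map Prod.fst = stdGaussianTensor n) {m : ℕ} {B₀ δ t : ℝ}
    (hδ : 0 < δ) (hW₀ : soverlapNorm W₀ ≤ B₀)
    (h : ∀ (k : ℕ) (W : Fin (k + 1) → Tensor n), (∀ j, soverlapNorm (W j) ≤ B₀) →
      (Measure.pi fun _ : Fin m => μ) {z | t < ⨆ j, deviation l μ W₀ (W j) z} ≤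
        ENNReal.ofReal δ) :
    ExcessRiskBound l μ m B₀ W₀ δ t := by
  have : Nonempty {W : Tensor n // soverlapNorm W ≤ B₀} := ⟨⟨W₀, hW₀⟩⟩
  -- A countable dense family keeps the good event measurable; continuity extends the bound to the
  -- whole ball.
  set d := TopologicalSpace.denseSeq {W : Tensor n // soverlapNorm W ≤ B₀} with hd
  set P := Measure.pi fun _ : Fin m => μ
  have hmeas : ∀ k, MeasurableSet {z : Fin m → Tensor n × Y | deviation l μ W₀ (d k) z ≤ t} :=
    fun k => measurableSet_le (measurable_deviation hl _ _) measurable_const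
  have hE : MeasurableSet (⋂ k, {z : Fin m → Tensor n × Y | deviation l μ W₀ (d k) z ≤ t}) :=
    MeasurableSet.iInter hmeas
  refine ⟨_, hE, ?_, ?_⟩
  · have hcompl : (⋂ k, {z : Fin m → Tensor n × Y | deviation l μ W₀ (d k) z ≤ t})ᶜ =
        ⋃ k : ℕ, {z | t < ⨆ j : Fin (k + 1), deviation l μ W₀ (d j) z} := by
      ext z
      simp only [Set.mem_compl_iff, Set.mem_iInter, Set.mem_ofPred_eq, Set.mem_iUnion, not_forall,
        not_le]
      constructor
      · rintro ⟨k, hk⟩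
        exact ⟨k, hk.trans_le (le_ciSup (f := fun j : Fin (k + 1) => deviation l μ W₀ (d j) z)
          (Set.finite_range _).bddAbove (Fin.last k))⟩
      · rintro ⟨k, hk⟩
        obtain ⟨j, hj⟩ := exists_lt_of_lt_ciSup hk
        exact ⟨j, hj⟩
    have hmono : Monotone fun k : ℕ =>
        {z : Fin m → Tensor n × Y | t < ⨆ j : Fin (k + 1), deviation l μ W₀ (d j) z} := by
      intro k k' hkk z (hz : t < ⨆ j : Fin (k + 1), deviation l μ W₀ (d j) z)
      refine lt_of_lt_of_le hz (ciSup_le fun j => ?_)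
      exact le_ciSup (f := fun j : Fin (k' + 1) => deviation l μ W₀ (d j) z)
        (Set.finite_range _).bddAbove ⟨j, by omega⟩
    have hle : P (⋂ k, {z : Fin m → Tensor n × Y | deviation l μ W₀ (d k) z ≤ t})ᶜ ≤
        ENNReal.ofReal δ := by
      rw [hcompl, hmono.measure_iUnion]
      exact iSup_le fun k => h k _ fun j => (d j).2
    have hprob := prob_add_prob_compl (μ := P) hE
    rw [ENNReal.ofReal_sub _ hδ.le, ENNReal.ofReal_one, ← hprob]
    exact tsub_le_iff_right.2 (by gcongr)
  · intro z hz W' hW'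
    simp only [Set.mem_iInter, Set.mem_ofPred_eq] at hz
    have hcont : Continuous fun W : {W : Tensor n // soverlapNorm W ≤ B₀} =>
        deviation l μ W₀ W z :=
      ((((continuous_risk hΛ hint hμ).sub continuous_const).sub
        ((continuous_empRisk hΛ z).sub continuous_const))).comp continuous_subtype_val
    have hclosed : IsClosed {W : {W : Tensor n // soverlapNorm W ≤ B₀} |
        deviation l μ W₀ W z ≤ t} := isClosed_le hcont continuous_const
    have hall := hclosed.closure_subset_iff.2 (Set.range_subset_iff.2 hz)
    rw [(TopologicalSpace.denseRange_denseSeq _).closure_range] at hall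
    have h1 : deviation l μ W₀ W' z ≤ t := hall (Set.mem_univ ⟨W', hW'.1⟩)
    have h2 := hW'.2 W₀ hW₀
    unfold deviation at h1
    linarith

theorem eexp_neg_log_inv {δ : ℝ} (hδ : 0 < δ) :
    eexp (-Real.log (1 / δ)) = ENNReal.ofReal δ := by
  rw [one_div, Real.log_inv, neg_neg, eexp, Real.exp_log hδ]

theorem iSup_le_iSup_add {ι : Type*} [Finite ι] [Nonempty ι] {u v : ι → ℝ} {c : ℝ}
    (h : ∀ j, u j ≤ v j + c) : ⨆ j, u j ≤ (⨆ j, v j) + c :=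
  ciSup_le fun j => (h j).trans <| by
    gcongr
    exact le_ciSup (Set.finite_range v).bddAbove j

theorem sqrt_add_le {x y : ℝ} (hx : 0 ≤ x) (hy : 0 ≤ y) : √(x + y) ≤ √x + √y := by
  refine Real.sqrt_le_iff.2 ⟨by positivity, ?_⟩
  nlinarith [Real.sq_sqrt hx, Real.sq_sqrt hy, Real.sqrt_nonneg x, Real.sqrt_nonneg y,
    mul_nonneg (Real.sqrt_nonneg x) (Real.sqrt_nonneg y)]

theorem sqrt_log_le {δ : ℝ} (hδ : 0 < δ) {m : ℕ} (hm : 0 < m) :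
    1 / √(m : ℝ) * √(2 * Real.log (1 / δ)) ≤ 2 * √(Real.log (2 / δ) / (2 * (m : ℝ))) := by
  have hm' : (0 : ℝ) < m := by exact_mod_cast hm
  have h1 : Real.log (1 / δ) ≤ Real.log (2 / δ) :=
    Real.log_le_log (by positivity) (by gcongr; norm_num)
  have h2 : √(2 * Real.log (1 / δ)) ≤ √(2 * Real.log (2 / δ)) := by gcongr
  have h3 : Real.log (2 / δ) / (2 * (m : ℝ)) = 2 * Real.log (2 / δ) / (4 * m) := by ring
  have h4 : √(4 * (m : ℝ)) = 2 * √(m : ℝ) := by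
    rw [Real.sqrt_mul (by norm_num), show (4 : ℝ) = 2 ^ 2 by norm_num, Real.sqrt_sq two_pos.le]
  rw [h3, Real.sqrt_div' _ (by positivity), h4]
  calc _ ≤ 1 / √(m : ℝ) * √(2 * Real.log (2 / δ)) := by gcongr
    _ = _ := by field_simp

section Main

variable (hl : Measurable (Function.uncurry l)) (hΛ : ∀ y : Y, LipschitzWith Λ fun a => l a y)
  (hint : ∀ W : Tensor n, Integrable (fun z => l (tensorInner W z.1) z.2) μ)
  (hμ : μ.map Prod.fst = stdGaussianTensor n)

include hl hΛ hint hμ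

/-- The excess risk bound for Lipschitz losses. -/
theorem excessRiskBound_lipschitz [IsProbabilityMeasure μ] (hK : 0 < K) (hn : ∀ k, 0 < n k)
    {m : ℕ} (hm : 0 < m) {B₀ δ : ℝ} (hW₀ : soverlapNorm W₀ ≤ B₀) (hδ : 0 < δ) (hδ1 : δ < 1) :
    ExcessRiskBound l μ m B₀ W₀ δ (16 * Λ * (B₀ / weightSum n) / √(m : ℝ) *
      √(2 * (5 * (weightSum n * dimFactor n) ^ 2 + Real.log (1 / δ)))) := by
  have hS := weightSum_pos hK hn
  have hB₀ : 0 ≤ B₀ := (soverlapNorm_nonneg W₀).trans hW₀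
  refine excessRiskBound_of_measure_le hl hΛ hint hμ hδ hW₀ fun k W hW => ?_
  rw [← eexp_neg_log_inv hδ]
  exact measure_gt_le_eexp (measurable_iSup_deviation hl W) (by positivity) (by positivity)
    (lintegral_eexp_iSup_deviation_le hl hΛ hint hμ hK hn hm hW hW₀)
    (Real.log_nonneg (by rw [le_div_iff₀ hδ]; linarith))

/-- The excess risk bound for bounded Lipschitz losses. -/
theorem excessRiskBound_bounded [IsProbabilityMeasure μ] (hK : 0 < K) (hn : ∀ k, 0 < n k)
    {m : ℕ} (hm : 0 < m) {B₀ δ : ℝ} (hW₀ : soverlapNorm W₀ ≤ B₀) (hδ : 0 < δ) (hδ1 : δ < 1)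
    (hl01 : ∀ a y, l a y ∈ Set.Icc (0 : ℝ) 1) :
    ExcessRiskBound l μ m B₀ W₀ δ (16 * Λ * (B₀ / weightSum n) / √(m : ℝ) *
      √(2 * (5 * (weightSum n * dimFactor n) ^ 2)) +
      1 / √(m : ℝ) * √(2 * Real.log (1 / δ))) := by
  have hS := weightSum_pos hK hn
  have hm' : (0 : ℝ) < m := by exact_mod_cast hm
  have hB₀ : 0 ≤ B₀ := (soverlapNorm_nonneg W₀).trans hW₀
  refine excessRiskBound_of_measure_le hl hΛ hint hμ hδ hW₀ fun k W hW => ?_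
  set φ : (Fin m → Tensor n × Y) → ℝ := fun z => ⨆ j, deviation l μ W₀ (W j) z with hφ
  have hφm : Measurable φ := measurable_iSup_deviation hl W
  have hemp : ∀ V (z : Fin m → Tensor n × Y), empRisk l z V ∈ Set.Icc (0 : ℝ) 1 := by
    intro V z
    have h1 : ∑ i, l (tensorInner V (z i).1) (z i).2 ≤ m := by
      refine (Finset.sum_le_sum fun i _ => (hl01 _ _).2).trans_eq ?_
      simp
    have h2 : 0 ≤ ∑ i, l (tensorInner V (z i).1) (z i).2 :=
      Finset.sum_nonneg fun i _ => (hl01 _ _).1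
    refine ⟨by unfold empRisk; positivity, ?_⟩
    rw [empRisk, one_div_mul_eq_div]
    exact div_le_one_of_le₀ h1 hm'.le
  have hrisk : ∀ V, risk l μ V ∈ Set.Icc (0 : ℝ) 1 := by
    intro V
    refine ⟨integral_nonneg fun z => (hl01 _ _).1, ?_⟩
    refine (integral_mono (hint V) (integrable_const 1) fun z => (hl01 _ _).2).trans_eq ?_
    simp
  have hφb : ∀ z, |φ z| ≤ 2 := by
    intro z
    have hb : ∀ j, |deviation l μ W₀ (W j) z| ≤ 2 := by
      intro j
      obtain ⟨a1, a2⟩ := hemp (W j) z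
      obtain ⟨b1, b2⟩ := hemp W₀ z
      obtain ⟨c1, c2⟩ := hrisk (W j)
      obtain ⟨d1, d2⟩ := hrisk W₀
      rw [deviation, abs_le]
      constructor <;> linarith
    obtain ⟨j, hj⟩ := exists_eq_ciSup_of_finite (f := fun j => deviation l μ W₀ (W j) z)
    rw [hφ]
    simp only
    rw [← hj]
    exact hb j
  -- The excess loss lies in `[-1, 1]`, so one sample point moves the mean by at most `2 / m`.
  have hdiff : ∀ z i x, φ (Function.update z i x) ≤ φ z + 2 / m := by
    intro z i x
    refine iSup_le_iSup_add fun j => ?_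
    rw [deviation_eq_sum hint hm, deviation_eq_sum hint hm, ← sub_le_iff_le_add',
      ← Finset.sum_sub_distrib, Finset.sum_eq_single i]
    · rw [Function.update_self, ← mul_sub, sub_sub_sub_cancel_left, one_div_mul_eq_div]
      gcongr
      unfold excessLoss
      linarith [(hl01 (tensorInner (W j) (z i).1) (z i).2).2,
        (hl01 (tensorInner W₀ (z i).1) (z i).2).1, (hl01 (tensorInner (W j) x.1) x.2).1,
        (hl01 (tensorInner W₀ x.1) x.2).2]
    · intro i' _ hi'
      rw [Function.update_of_ne hi', sub_self]
    · simp
  have hφi : Integrable φ (Measure.pi fun _ => μ) :=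
    Integrable.of_bound hφm.aestronglyMeasurable 2 (ae_of_all _ hφb)
  have hmean := integral_le_of_lintegral_eexp_le hφi (by positivity) (by positivity)
    (lintegral_eexp_iSup_deviation_le hl hΛ hint hμ hK hn hm hW hW₀)
  -- McDiarmid's exponent is `c² m (2/m)² / 8 = c² / (2m)`, that is, `A = 0` and `s = 1/√m`.
  have hconc := measure_gt_le_eexp (μ := Measure.pi fun _ : Fin m => μ)
    (X := fun z => φ z - ∫ w, φ w ∂(Measure.pi fun _ => μ)) (A := 0) (s := 1 / √(m : ℝ))
    (D := Real.log (1 / δ)) (hφm.sub_const _) le_rfl (by positivity)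
    (fun c _ => (lintegral_eexp_le_of_bounded_differences hφm hφb hdiff c).trans_eq <| by
      congr 1
      rw [div_pow, div_pow, Real.sq_sqrt hm'.le]
      field_simp
      ring)
    (Real.log_nonneg (by rw [le_div_iff₀ hδ]; linarith))
  rw [zero_add, eexp_neg_log_inv hδ] at hconc
  refine (measure_mono fun z hz => ?_).trans hconc
  have hz' : _ < φ z := hz
  simp only [Set.mem_ofPred_eq]
  linarith

end Main

/-- Monotonicity of excess risk bounds. -/
theorem ExcessRiskBound.mono {m : ℕ} {B₀ δ ε ε' : ℝ} (h : ExcessRiskBound l μ m B₀ W₀ δ ε)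
    (hε : ε ≤ ε') : ExcessRiskBound l μ m B₀ W₀ δ ε' := by
  obtain ⟨E, hE, hP, hb⟩ := h
  exact ⟨E, hE, hP, fun z hz W' hW' => (hb z hz W' hW').trans hε⟩

theorem dimFactor_nonneg (n : Fin K → ℕ) : 0 ≤ dimFactor n :=
  Real.iInf_nonneg fun k => by positivity

/-- The weight sum cancels, and `√10 ≤ 4` turns `16` into `64`. -/
theorem complexity_le (hK : 0 < K) (hn : ∀ k, 0 < n k) {m : ℕ} {B₀ C : ℝ} (hB₀ : 0 ≤ B₀)
    (hC : B₀ ≤ C) :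
    16 * (Λ : ℝ) * (B₀ / weightSum n) / √(m : ℝ) * √(2 * (5 * (weightSum n * dimFactor n) ^ 2)) ≤
      64 * Λ * (C / √(m : ℝ)) * dimFactor n := by
  have hS := weightSum_pos hK hn
  have hM := dimFactor_nonneg n
  have h1 : √(2 * (5 * (weightSum n * dimFactor n) ^ 2)) ≤ 4 * (weightSum n * dimFactor n) := by
    refine Real.sqrt_le_iff.2 ⟨by positivity, ?_⟩
    nlinarith [sq_nonneg (weightSum n * dimFactor n)]
  calc _ ≤ 16 * (Λ : ℝ) * (B₀ / weightSum n) / √(m : ℝ) *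
        (4 * (weightSum n * dimFactor n)) := by gcongr
    _ = 64 * Λ * (B₀ / √(m : ℝ)) * dimFactor n := by field_simp; ring
    _ ≤ _ := by gcongr

end RiskBounds

end TensorRisk

theorem mainTheorem5 :
    (∀ (K : ℕ) (n : Fin K → ℕ), (∀ k, 0 < n k) → ∀ W : TensorRisk.Tensor n,
      TensorRisk.soverlapNorm W ≤
        (∑ k, √((TensorRisk.modeRank W k : ℝ) / (n k : ℝ))) * TensorRisk.frobNorm W) ∧
    ∃ c₁ : ℝ, 0 < c₁ ∧ ∃ c₂ : ℝ, 0 < c₂ ∧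
      ∀ (K : ℕ), 0 < K → ∀ (n : Fin K → ℕ), (∀ k, 0 < n k) → ∀ (m : ℕ), 0 < m →
      ∀ (Y : Set ℝ) (l : ℝ → Y → ℝ) (Λ : ℝ≥0),
        Measurable (Function.uncurry l) → (∀ y : Y, LipschitzWith Λ fun a => l a y) →
      ∀ μ : Measure (TensorRisk.Tensor n × Y), IsProbabilityMeasure μ →
        μ.map Prod.fst = TensorRisk.stdGaussianTensor n →
        (∀ W : TensorRisk.Tensor n,
          Integrable (fun z => l (TensorRisk.tensorInner W z.1) z.2) μ) →
      ∀ (B B₀ : ℝ) (W₀ : TensorRisk.Tensor n),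
        TensorRisk.IsConstrainedMin (TensorRisk.risk l μ) B₀ W₀ →
        TensorRisk.frobNorm W₀ ≤ B →
        B₀ ≤ B * ∑ k, √((TensorRisk.modeRank W₀ k : ℝ) / (n k : ℝ)) →
      ∀ δ : ℝ, 0 < δ → δ < 1 →
        ((∀ a y, l a y ∈ Set.Icc (0 : ℝ) 1) →
          TensorRisk.ExcessRiskBound l μ m B₀ W₀ δ
            (c₁ * Λ * (B / √(m : ℝ)) * (∑ k, √((TensorRisk.modeRank W₀ k : ℝ) / (n k : ℝ))) *
                (⨅ k, ((n k : ℝ) + √((∏ j, n j : ℕ) : ℝ))) +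
              c₂ * √(Real.log (2 / δ) / (2 * (m : ℝ))))) ∧
        (∀ ρ : ℝ, (∀ W : TensorRisk.Tensor n, TensorRisk.soverlapNorm W ≤ B₀ →
            TensorRisk.frobNorm W ≤ ρ) →
          TensorRisk.ExcessRiskBound l μ m B₀ W₀ δ
            (c₁ * Λ * (B / √(m : ℝ)) * (∑ k, √((TensorRisk.modeRank W₀ k : ℝ) / (n k : ℝ))) *
                (⨅ k, ((n k : ℝ) + √((∏ j, n j : ℕ) : ℝ))) +
              c₂ * (Λ * ρ) * √(Real.log (2 / δ) / (2 * (m : ℝ))))) := by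
  -- `64` comes from `complexity_le`; `32` is `16` times the `2` of `sqrt_log_le`, as (b) requires.
  refine ⟨fun K n _ W => TensorRisk.soverlapNorm_le_sum_sqrt_mul_frobNorm W, 64, by norm_num,
    32, by norm_num, ?_⟩
  intro K hK n hn m hm Y l Λ hl hΛ μ hprob hμ hint B B₀ W₀ hW₀ _ hB₀B δ hδ hδ1
  have hS := TensorRisk.weightSum_pos hK hn
  have hB₀ : 0 ≤ B₀ := (TensorRisk.soverlapNorm_nonneg W₀).trans hW₀.1
  have hcomp := TensorRisk.complexity_le (Λ := Λ) hK hn (m := m) hB₀ hB₀B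
  have hlog := TensorRisk.sqrt_log_le hδ hm
  have heq : 64 * (Λ : ℝ) *
      (B * (∑ k, √((TensorRisk.modeRank W₀ k : ℝ) / (n k : ℝ))) / √(m : ℝ)) *
      TensorRisk.dimFactor n = 64 * Λ * (B / √(m : ℝ)) *
      (∑ k, √((TensorRisk.modeRank W₀ k : ℝ) / (n k : ℝ))) *
      (⨅ k, ((n k : ℝ) + √((∏ j, n j : ℕ) : ℝ))) := by
    rw [TensorRisk.dimFactor]; ring
  rw [heq] at hcomp
  refine ⟨fun hl01 => ?_, fun ρ hρ => ?_⟩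
  · refine (TensorRisk.excessRiskBound_bounded hl hΛ hint hμ hK hn hm hW₀.1 hδ hδ1 hl01).mono ?_
    have : 0 ≤ √(Real.log (2 / δ) / (2 * (m : ℝ))) := Real.sqrt_nonneg _
    linarith
  · refine (TensorRisk.excessRiskBound_lipschitz hl hΛ hint hμ hK hn hm hW₀.1 hδ hδ1).mono ?_
    have hlog0 : 0 ≤ Real.log (1 / δ) := Real.log_nonneg (by rw [le_div_iff₀ hδ]; linarith)
    have hρ' := TensorRisk.div_weightSum_le hK hn hB₀ hρ
    have hρ0 : 0 ≤ B₀ / TensorRisk.weightSum n := by positivity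
    have hdev : 16 * (Λ * (B₀ / TensorRisk.weightSum n)) *
        (1 / √(m : ℝ) * √(2 * Real.log (1 / δ))) ≤
        16 * (Λ * ρ) * (2 * √(Real.log (2 / δ) / (2 * (m : ℝ)))) := by
      have : 0 ≤ ρ := hρ0.trans hρ'
      gcongr
    have hsplit : √(2 * (5 * (TensorRisk.weightSum n * TensorRisk.dimFactor n) ^ 2 +
        Real.log (1 / δ))) ≤ √(2 * (5 * (TensorRisk.weightSum n * TensorRisk.dimFactor n) ^ 2)) +
          √(2 * Real.log (1 / δ)) := by
      rw [mul_add]; exact TensorRisk.sqrt_add_le (by positivity) (by positivity)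
    calc _ ≤ 16 * (Λ : ℝ) * (B₀ / TensorRisk.weightSum n) / √(m : ℝ) *
          (√(2 * (5 * (TensorRisk.weightSum n * TensorRisk.dimFactor n) ^ 2)) +
            √(2 * Real.log (1 / δ))) := by gcongr
      _ = 16 * (Λ : ℝ) * (B₀ / TensorRisk.weightSum n) / √(m : ℝ) *
          √(2 * (5 * (TensorRisk.weightSum n * TensorRisk.dimFactor n) ^ 2)) +
          16 * (Λ * (B₀ / TensorRisk.weightSum n)) *
            (1 / √(m : ℝ) * √(2 * Real.log (1 / δ))) := by ring
      _ ≤ _ := by linarith
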